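/- **Setting.** Let $p,q\ge 1$ be integers and $0<s<1$. For $r>0$ put $\Delta_r=\{(x_1,x_2)\in\mathbb C^2: |x_1|^p<r,\ |x_2|^q<r\}$, and for real $a<b$ let $\Pi(a,b,r)$ be the set of $(x_1,x_2)\in\Delta_r$ with $x_1x_2\ne 0$ such that some determination of $\arg(x_1^px_2^q)$ lies in $(a,b)$. A formal series $\hat f=\sum a_{n,m}x_1^nx_2^m$ with coefficients in $\mathbb C^l$ is written uniquely as $\hat f=\sum_{n\ge0} f_n\,(x_1^px_2^q)^n$ with $f_n=\sum_{m<p\text{ or }j<q}a_{np+m,nq+j}x_1^mx_2^j$. The series $\hat f$ is *1-summable in $x_1^px_2^q$ in the direction $d\in\mathbb R$* if there are $a,b,r$ with $r>0$, $(a+b)/2=d$, $\pi<b-a\le 2\pi$, a holomorphic map $f:\Pi(a,b,r)\to\mathbb C^l$ and $0<r'\le r$ such that all $f_n$ converge to bounded holomorphic maps on $\Delta_{r'}$ and, for all $a<a'<b'<b$ and $0<\rho<r'$, there are $K,A>0$ with $$\Big\|f(x_1,x_2)-\sum_{n=0}^{N-1}f_n(x_1,x_2)(x_1^px_2^q)^n\Big\|\le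 K A^N N!\,|x_1^px_2^q|^N$$ for all $N\in\mathbb N$ and $(x_1,x_2)\in\Pi(a',b',\rho)$. Directions in which this fails are called *singular*. The series $\hat f$ is *1-summable in $x_1^px_2^q$* if it has only finitely many singular directions modulo $2\pi$. **Theorem 5.2.** Let $C$ be an $l\times l$ matrix and $\gamma$ a vector of size $l$ whose entries are holomorphic functions on a polydisc $\{|x_1|<R,\ |x_2|<R\}$, $R>0$, and assume that $C(0,0)$ is invertible. Then the equation $$x_1^px_2^q\left(\frac sp\,x_1\frac{\partial y}{\partial x_1}+\frac{1-s}{q}\,x_2\frac{\partial y}{\partial x_2}\right)=C(x_1,x_2)\,y+\gamma(x_1,x_2)$$ has a unique formal power series solution $\hat y\in\mathbb C[[x_1,x_2]]^l$. It is 1-summable in $x_1^px_2^q$, and every singular direction of $\hat y$ is, modulo $2\pi$, the argument of an eigenvalue of $C(0,0)$. -/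

import Mathlib

namespace MonomialSummability

open Set

/-- The open polydisc `|x₁|^p < r`, `|x₂|^q < r`. -/
def polydisc (p q : ℕ) (r : ℝ) : Set (ℂ × ℂ) :=
  {x | ‖x.1‖ ^ p < r ∧ ‖x.2‖ ^ q < r}

/-- The sector `Π_{p,q}(a,b,r)` in the monomial `x₁^p x₂^q`: the points with
`0 < |x₁|^p, |x₂|^q < r` such that some determination `θ` of the argument of `x₁^p x₂^q`
satisfies `a < θ < b`. -/
def sector (p q : ℕ) (a b r : ℝ) : Set (ℂ × ℂ) :=
  {x | x.1 ≠ 0 ∧ x.2 ≠ 0 ∧ x ∈ polydisc p q r ∧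
    ∃ θ ∈ Ioo a b, ((x.1 ^ p * x.2 ^ q).arg : Real.Angle) = (θ : Real.Angle)}

section Asymptotics

variable {E : Type*} [NormedAddCommGroup E] [NormedSpace ℂ E]

/-- Given a formal series `∑ a n m x₁^n x₂^m`, the map `g` is a bounded holomorphic map on the
polydisc of radius `r` which is the sum of the power series
`f_n = ∑_{m < p or j < q} a (n p + m) (n q + j) x₁^m x₂^j`, the `n`-th coefficient in the
decomposition `∑ f_n (x₁^p x₂^q)^n` of the formal series. -/
def IsMonomialCoeff (p q : ℕ) (a : ℕ → ℕ → E) (r : ℝ) (n : ℕ) (g : ℂ × ℂ → E) : Prop :=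
  DifferentiableOn ℂ g (polydisc p q r) ∧
  (∃ M : ℝ, ∀ x ∈ polydisc p q r, ‖g x‖ ≤ M) ∧
  ∀ x ∈ polydisc p q r,
    HasSum (fun k : ℕ × ℕ => if k.1 < p ∨ k.2 < q then
        (x.1 ^ k.1 * x.2 ^ k.2) • a (n * p + k.1) (n * q + k.2) else 0) (g x)

/-- `f` has `∑ a n m x₁^n x₂^m` as asymptotic expansion of `σ`-Gevrey type in the monomial
`x₁^p x₂^q` on the sector `Π_{p,q}(α,β,r)`. -/
def HasGevreyExpansion (p q : ℕ) (σ : ℝ) (f : ℂ × ℂ → E) (a : ℕ → ℕ → E) (α β r : ℝ) : Prop :=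
  ∃ r' : ℝ, 0 < r' ∧ r' ≤ r ∧ ∃ g : ℕ → ℂ × ℂ → E,
    (∀ n, IsMonomialCoeff p q a r' n (g n)) ∧
    ∀ α' β' ρ : ℝ, α < α' → α' < β' → β' < β → 0 < ρ → ρ < r' →
      ∃ K A : ℝ, 0 < K ∧ 0 < A ∧ ∀ N : ℕ, ∀ x ∈ sector p q α' β' ρ,
        ‖f x - ∑ n ∈ Finset.range N, (x.1 ^ p * x.2 ^ q) ^ n • g n x‖ ≤
          K * A ^ N * (N.factorial : ℝ) ^ σ * ‖x.1 ^ p * x.2 ^ q‖ ^ N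

/-- The formal series `∑ a n m x₁^n x₂^m` is 1-summable in `x₁^p x₂^q` in the direction `d`:
on some sector with bisecting direction `d` and opening greater than `π` there is a holomorphic
map having the series as 1-Gevrey asymptotic expansion in the monomial. (Shrinking the sector
shows that only openings at most `2π`, for which the sector is a subset of `ℂ²` with
a single-valued argument of the monomial, have to be considered.) -/
def OneSummableInDirection (p q : ℕ) (a : ℕ → ℕ → E) (d : ℝ) : Prop :=
  ∃ α β r : ℝ, (α + β) / 2 = d ∧ Real.pi < β - α ∧ β - α ≤ 2 * Real.pi ∧ 0 < r ∧
    ∃ f : ℂ × ℂ → E, DifferentiableOn ℂ f (sector p q α β r) ∧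
      HasGevreyExpansion p q 1 f a α β r

/-- The set of singular directions, taken modulo `2π`. -/
def singularDirections (p q : ℕ) (a : ℕ → ℕ → E) : Set Real.Angle :=
  (fun d : ℝ => (d : Real.Angle)) '' {d : ℝ | ¬ OneSummableInDirection p q a d}

/-- 1-summability in `x₁^p x₂^q`: in every direction with finitely many exceptions mod `2π`. -/
def OneSummable (p q : ℕ) (a : ℕ → ℕ → E) : Prop :=
  (singularDirections p q a).Finite

end Asymptotics

/-- The Taylor series at the origin of a function of two complex variables. -/
noncomputable def taylorSeries (h : ℂ × ℂ → ℂ) : MvPowerSeries (Fin 2) ℂ := fun e =>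
  iteratedDeriv (e 0) (fun x₁ => iteratedDeriv (e 1) (fun x₂ => h (x₁, x₂)) 0) 0 /
    (((e 0).factorial : ℂ) * ((e 1).factorial : ℂ))

/-- The vector-valued coefficients of a vector of formal power series. -/
noncomputable def vectorCoeff {l : ℕ} (y : Fin l → MvPowerSeries (Fin 2) ℂ) :
    ℕ → ℕ → (Fin l → ℂ) :=
  fun n m i => MvPowerSeries.coeff (Finsupp.single 0 n + Finsupp.single 1 m) (y i)

/-- `y` is a formal power series solution of
`x₁^p x₂^q ((s/p) x₁ ∂y/∂x₁ + ((1-s)/q) x₂ ∂y/∂x₂) = C(x₁,x₂) y + γ(x₁,x₂)`. -/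
def IsFormalSolution {l : ℕ} (p q : ℕ) (s : ℝ) (C : ℂ × ℂ → Matrix (Fin l) (Fin l) ℂ)
    (γ : ℂ × ℂ → Fin l → ℂ) (y : Fin l → MvPowerSeries (Fin 2) ℂ) : Prop :=
  ∀ i : Fin l,
    (MvPowerSeries.X 0 ^ p * MvPowerSeries.X 1 ^ q) *
      (((s : ℂ) / (p : ℂ)) • (MvPowerSeries.X 0 * MvPowerSeries.pderiv ℂ 0 (y i)) +
        ((1 - (s : ℂ)) / (q : ℂ)) • (MvPowerSeries.X 1 * MvPowerSeries.pderiv ℂ 1 (y i))) =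
    ∑ j : Fin l, taylorSeries (fun x => C x i j) * y j + taylorSeries (fun x => γ x i)

end MonomialSummability

/-! ### Cauchy estimates in one and two variables -/

namespace MonomialSummability

open Set Metric Filter Topology

variable {E : Type*} [NormedAddCommGroup E] [NormedSpace ℂ E]

/-! Write κ = (p,q) and treat the monomial t = x^κ as an extra variable. The Euler operator
multiplies x^k by λ_k (`eulerWeight`), and λ_κ = 1, so it multiplies t^n x^k by n + λ_k. A solution
∑ F_{n,k} t^n x^k of the equation in (t, x) satisfies ∑ C_j F_{0,k-j} = -γ_k and ∑ C_j F_{n+1,k-j} =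
(n + λ_k) F_{n,k}. Substituting t = x^κ gives the formal solution (`unfoldedCoeff_equation`). It is
unique because C(0,0) is injective and thus determines the coefficients degree by degree.

The Borel transforms U_k(ξ) = ∑ F_{n,k} ξ^n / n! satisfy ∑ C_j U_{k-j}' - ξ U_k' = λ_k U_k, whose
leading operator C(0,0) - ξ degenerates only at the eigenvalues of C(0,0). If d is not the argument
of an eigenvalue, a convex domain Ω containing a cone around d stays away from all of them
(`isBorelDomain_coneDomain`), and every U_k is holomorphic on Ω.

The main difficulty is a bound ‖U_k'‖ ≤ M Q^|k| on all of Ω, although λ_k is unbounded. For the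
scalar equation (μ - ξ) u' = λ u + H, the weight exp(-λ c / (1 + |ξ|)) gives a bound with a constant
independent of λ (`exists_scalar_solution`). Cayley-Hamilton reduces the system to scalar equations
without a Jordan form (`exists_solution_of_list`). The weights are multiplicative in λ and lie
between exp(-cλ) and 1. As λ_k ≤ |k|, the convolution with C costs only a geometric factor
(`exists_borel_family`).

Each U_k is then summed as U_k(0) plus the Laplace transform of U_k'. Two rays on either side of d
give a sector in t of opening larger than π (`exists_borel_sum`). Regrouping the exponents k modulo
multiples of κ yields the Gevrey expansion in the monomial (`exists_hasGevreyExpansion`). By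
uniqueness, the series built for different d coincide. -/

theorem norm_fderiv_le_of_norm_le {V : Type*} [NormedAddCommGroup V] [NormedSpace ℂ V]
    {f : V → E} {x : V} {ρ M : ℝ} (hρ : 0 < ρ) (hM : 0 ≤ M)
    (hf : DifferentiableOn ℂ f (ball x (2 * ρ))) (hb : ∀ z ∈ ball x (2 * ρ), ‖f z‖ ≤ M) :
    ‖fderiv ℂ f x‖ ≤ M / ρ := by
  refine ContinuousLinearMap.opNorm_le_bound _ (by positivity) fun v => ?_
  rcases eq_or_ne v 0 with rfl | hv
  · simp
  have hv' : 0 < ‖v‖ := norm_pos_iff.2 hv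
  have hmem : ∀ w : ℂ, w ∈ closedBall (0 : ℂ) (ρ / ‖v‖) → x + w • v ∈ ball x (2 * ρ) := by
    intro w hw
    rw [mem_closedBall_zero_iff, le_div_iff₀ hv'] at hw
    rw [mem_ball, dist_eq_norm, add_sub_cancel_left, norm_smul]
    linarith
  have hx : DifferentiableAt ℂ f x := hf.differentiableAt (ball_mem_nhds x (by positivity))
  have hd : HasDerivAt (fun w : ℂ => f (x + w • v)) (fderiv ℂ f x v) 0 := by
    have h1 : HasDerivAt (fun w : ℂ => x + w • v) v 0 := by
      simpa using ((hasDerivAt_id (0 : ℂ)).smul_const v).const_add x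
    have h2 : HasFDerivAt f (fderiv ℂ f x) (x + (0 : ℂ) • v) := by simpa using hx.hasFDerivAt
    exact h2.comp_hasDerivAt (0 : ℂ) h1
  have hdiff : DifferentiableOn ℂ (fun w : ℂ => f (x + w • v)) (closedBall 0 (ρ / ‖v‖)) :=
    hf.comp (by fun_prop) hmem
  have := Complex.norm_deriv_le_of_forall_mem_sphere_norm_le (c := 0) (R := ρ / ‖v‖) (C := M)
    (by positivity) (hdiff.diffContOnCl_ball subset_rfl) (fun z hz => hb _ (hmem z (sphere_subset_closedBall hz)))
  rw [hd.deriv] at this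
  calc ‖fderiv ℂ f x v‖ ≤ M / (ρ / ‖v‖) := this
    _ = M / ρ * ‖v‖ := by field_simp

/-- A normally convergent series of holomorphic maps is holomorphic. -/
theorem differentiableOn_tsum_of_norm_le {ι V : Type*} [NormedAddCommGroup V] [NormedSpace ℂ V]
    [CompleteSpace E] {U : Set V} (hU : IsOpen U) {f : ι → V → E} {u : ι → ℝ} (hu : Summable u)
    (hf : ∀ i, DifferentiableOn ℂ (f i) U) (hb : ∀ i, ∀ x ∈ U, ‖f i x‖ ≤ u i) :
    DifferentiableOn ℂ (fun x => ∑' i, f i x) U := by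
  intro x hx
  obtain ⟨ε, hε, hεU⟩ := Metric.isOpen_iff.1 hU x hx
  have hu0 : ∀ i, 0 ≤ u i := fun i => (norm_nonneg _).trans (hb i x hx)
  have hsub : ∀ z ∈ ball x (ε / 2), ball z (2 * (ε / 4)) ⊆ U := fun z hz =>
    (ball_subset_ball' (by rw [mem_ball] at hz; linarith)).trans hεU
  refine (hasFDerivAt_tsum_of_isPreconnected (𝕜 := ℂ) (hu.div_const (ε / 4)) isOpen_ball
    (convex_ball x (ε / 2)).isPreconnected (f' := fun i z => fderiv ℂ (f i) z) (fun i z hz => ?_)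
    (fun i z hz => ?_) (mem_ball_self (by positivity)) ?_
    (mem_ball_self (by positivity))).differentiableAt.differentiableWithinAt
  · exact ((hf i).differentiableAt
      (hU.mem_nhds (hsub z hz (mem_ball_self (by positivity))))).hasFDerivAt
  · exact norm_fderiv_le_of_norm_le (by positivity) (hu0 i) ((hf i).mono (hsub z hz))
      fun w hw => hb i w (hsub z hz hw)
  · exact .of_norm_bounded hu fun i => hb i x hx

/-- Cauchy's estimate for the Taylor remainder. -/
theorem norm_sub_taylor_le [CompleteSpace E] {f : ℂ → E} {ρ M : ℝ} (hρ : 0 < ρ)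
    (hf : DifferentiableOn ℂ f (closedBall 0 ρ)) (hb : ∀ z ∈ closedBall (0 : ℂ) ρ, ‖f z‖ ≤ M)
    (N : ℕ) {ξ : ℂ} (hξ : ‖ξ‖ ≤ ρ / 2) :
    ‖f ξ - ∑ n ∈ Finset.range N, (ξ ^ n / (n.factorial : ℂ)) • iteratedDeriv n f 0‖
      ≤ 2 * M * (‖ξ‖ / ρ) ^ N := by
  have hM : 0 ≤ M := (norm_nonneg _).trans (hb 0 (mem_closedBall_self hρ.le))
  have hx1 : ‖ξ‖ / ρ ≤ 1 / 2 := by rw [div_le_iff₀ hρ]; linarith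
  have hx0 : 0 ≤ ‖ξ‖ / ρ := by positivity
  have hsum := Complex.hasSum_taylorSeries_on_ball (hf.mono ball_subset_closedBall)
    (z := ξ) (by rw [mem_ball_zero_iff]; linarith)
  have hterm : ∀ n : ℕ, ‖(ξ ^ n / (n.factorial : ℂ)) • iteratedDeriv n f 0‖
      ≤ M * (‖ξ‖ / ρ) ^ n := by
    intro n
    have h := Complex.norm_iteratedDeriv_le_of_forall_mem_sphere_norm_le n hρ
      (hf.diffContOnCl_ball subset_rfl) (fun z hz => hb z (sphere_subset_closedBall hz))
    have hn : (0 : ℝ) < n.factorial := by exact_mod_cast n.factorial_pos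
    rw [norm_smul, norm_div, norm_pow, Complex.norm_natCast]
    calc ‖ξ‖ ^ n / n.factorial * ‖iteratedDeriv n f 0‖
        ≤ ‖ξ‖ ^ n / n.factorial * (n.factorial * M / ρ ^ n) := by gcongr
      _ = M * (‖ξ‖ / ρ) ^ n := by rw [div_pow]; field_simp
  have hsum' : HasSum (fun n : ℕ => (ξ ^ n / (n.factorial : ℂ)) • iteratedDeriv n f 0) (f ξ) := by
    convert hsum using 2 with n
    rw [sub_zero, smul_smul, div_eq_inv_mul]
  rw [← hasSum_nat_add_iff' N] at hsum'
  have hgeo : HasSum (fun n : ℕ => M * (‖ξ‖ / ρ) ^ (n + N))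
      (M * (‖ξ‖ / ρ) ^ N * (1 - ‖ξ‖ / ρ)⁻¹) := by
    have := (hasSum_geometric_of_lt_one hx0 (by linarith)).mul_left (M * (‖ξ‖ / ρ) ^ N)
    refine this.congr_fun fun n => ?_
    rw [pow_add]; ring
  refine (hsum'.norm_le_of_bounded hgeo fun n => hterm (n + N)).trans ?_
  have : (1 - ‖ξ‖ / ρ)⁻¹ ≤ 2 := by
    rw [inv_le_comm₀ (by linarith) (by norm_num)]; linarith
  calc M * (‖ξ‖ / ρ) ^ N * (1 - ‖ξ‖ / ρ)⁻¹ ≤ M * (‖ξ‖ / ρ) ^ N * 2 := by gcongr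
    _ = _ := by ring

/-- The partial derivatives in the second variable of a holomorphic function of two variables are
holomorphic in the first variable. -/
theorem differentiableOn_iteratedDeriv_snd [CompleteSpace E] {h : ℂ × ℂ → E} {R M : ℝ} (hR : 0 < R)
    (hh : DifferentiableOn ℂ h (closedBall 0 R ×ˢ closedBall 0 R))
    (hb : ∀ x ∈ closedBall (0 : ℂ) R ×ˢ closedBall (0 : ℂ) R, ‖h x‖ ≤ M) (m : ℕ) :
    DifferentiableOn ℂ (fun x₁ => iteratedDeriv m (fun x₂ => h (x₁, x₂)) 0) (ball 0 R) := by
  induction m using Nat.strong_induction_on with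
  | _ m ih =>
  have hslice : ∀ x₁ ∈ closedBall (0 : ℂ) R,
      DifferentiableOn ℂ (fun x₂ => h (x₁, x₂)) (closedBall 0 R) := fun x₁ hx₁ =>
    hh.comp (by fun_prop) fun x₂ hx₂ => ⟨hx₁, hx₂⟩
  -- A sequence of nonzero points tending to 0: the m-th derivative at 0 is the limit of m!/z^m
  -- times the Taylor remainder of order m at z, uniformly in x₁. By induction each approximant is
  -- holomorphic in x₁.
  let z : ℕ → ℂ := fun n => ((R / 2 * (1 / ((n : ℝ) + 1)) : ℝ) : ℂ)
  have hzn : ∀ n, ‖z n‖ = R / 2 * (1 / ((n : ℝ) + 1)) := fun n => by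
    rw [Complex.norm_real, Real.norm_of_nonneg (by positivity)]
  have hz0 : ∀ n, z n ≠ 0 := fun n => by rw [← norm_pos_iff, hzn]; positivity
  have hzR : ∀ n, ‖z n‖ ≤ R / 2 := fun n => by
    rw [hzn]
    refine mul_le_of_le_one_right (by positivity) ?_
    rw [div_le_one (by positivity)]; linarith [n.cast_nonneg (α := ℝ)]
  have hfac : (m.factorial : ℂ) ≠ 0 := by exact_mod_cast m.factorial_ne_zero
  let F : ℕ → ℂ → E := fun n x₁ => ((m.factorial : ℂ) / z n ^ m) • (h (x₁, z n) -
    ∑ j ∈ Finset.range m, (z n ^ j / (j.factorial : ℂ)) •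
      iteratedDeriv j (fun x₂ => h (x₁, x₂)) 0)
  have hF : ∀ n, DifferentiableOn ℂ (F n) (ball 0 R) := by
    intro n
    refine DifferentiableOn.const_smul (DifferentiableOn.sub ?_ ?_) _
    · refine hh.comp (by fun_prop) fun x₁ hx₁ => ⟨ball_subset_closedBall hx₁, ?_⟩
      rw [mem_closedBall_zero_iff]; linarith [hzR n]
    · exact DifferentiableOn.fun_sum fun j hj =>
        (ih j (Finset.mem_range.1 hj)).const_smul _
  have hlim : TendstoUniformlyOn F (fun x₁ => iteratedDeriv m (fun x₂ => h (x₁, x₂)) 0) atTop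
      (ball 0 R) := by
    rw [Metric.tendstoUniformlyOn_iff]
    intro ε hε
    have ht : Tendsto (fun n : ℕ => (m.factorial : ℝ) * (2 * M) / R ^ (m + 1) *
        (R / 2 * (1 / ((n : ℝ) + 1)))) atTop (𝓝 0) := by
      have := tendsto_one_div_add_atTop_nhds_zero_nat (𝕜 := ℝ)
      simpa using (this.const_mul (R / 2)).const_mul ((m.factorial : ℝ) * (2 * M) / R ^ (m + 1))
    filter_upwards [ht.eventually (gt_mem_nhds hε)] with n hn x₁ hx₁
    refine lt_of_le_of_lt ?_ hn
    rw [dist_comm, dist_eq_norm]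
    have hrem := norm_sub_taylor_le hR (hslice x₁ (ball_subset_closedBall hx₁))
      (fun w hw => hb (x₁, w) ⟨ball_subset_closedBall hx₁, hw⟩) (m + 1) (hzR n)
    rw [Finset.sum_range_succ, ← sub_sub] at hrem
    have hsplit : F n x₁ - iteratedDeriv m (fun x₂ => h (x₁, x₂)) 0 =
        ((m.factorial : ℂ) / z n ^ m) • (h (x₁, z n) -
          ∑ j ∈ Finset.range m, (z n ^ j / (j.factorial : ℂ)) •
            iteratedDeriv j (fun x₂ => h (x₁, x₂)) 0 -
          (z n ^ m / (m.factorial : ℂ)) • iteratedDeriv m (fun x₂ => h (x₁, x₂)) 0) := by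
      rw [smul_sub _ _ ((z n ^ m / (m.factorial : ℂ)) • _), smul_smul,
        div_mul_div_cancel₀ (pow_ne_zero _ (hz0 n)), div_self hfac, one_smul]
    rw [hsplit, norm_smul, norm_div, norm_pow, Complex.norm_natCast]
    have hpos : 0 < ‖z n‖ := norm_pos_iff.2 (hz0 n)
    calc (m.factorial : ℝ) / ‖z n‖ ^ m * _
        ≤ (m.factorial : ℝ) / ‖z n‖ ^ m * (2 * M * (‖z n‖ / R) ^ (m + 1)) := by gcongr
      _ = (m.factorial : ℝ) * (2 * M) / R ^ (m + 1) * ‖z n‖ := by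
          rw [div_pow, pow_succ ‖z n‖]; field_simp
      _ = _ := by rw [hzn]
  exact hlim.tendstoLocallyUniformlyOn.differentiableOn (.of_forall hF) isOpen_ball

/-- Cauchy's estimates for the Taylor coefficients of a holomorphic function of two variables. -/
theorem exists_norm_taylorSeries_le {h : ℂ × ℂ → ℂ} {r R : ℝ} (hR : 0 < R) (hRr : R < r)
    (hh : DifferentiableOn ℂ h (ball 0 r ×ˢ ball 0 r)) :
    ∃ M : ℝ, 0 ≤ M ∧ ∀ e : Fin 2 →₀ ℕ,
      ‖MvPowerSeries.coeff e (taylorSeries h)‖ ≤ M * ((R / 2) ^ (e 0 + e 1))⁻¹ := by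
  have hh' : DifferentiableOn ℂ h (closedBall 0 R ×ˢ closedBall 0 R) :=
    hh.mono (prod_mono (closedBall_subset_ball hRr) (closedBall_subset_ball hRr))
  obtain ⟨M, hM⟩ := ((isCompact_closedBall (0 : ℂ) R).prod
    (isCompact_closedBall (0 : ℂ) R)).exists_bound_of_continuousOn hh'.continuousOn
  have hM0 : 0 ≤ M := (norm_nonneg _).trans
    (hM 0 ⟨mem_closedBall_self hR.le, mem_closedBall_self hR.le⟩)
  refine ⟨M, hM0, fun e => ?_⟩
  have hin : ∀ x₁ ∈ ball (0 : ℂ) R, ‖iteratedDeriv (e 1) (fun x₂ => h (x₁, x₂)) 0‖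
      ≤ (e 1).factorial * M / R ^ e 1 := fun x₁ hx₁ =>
    Complex.norm_iteratedDeriv_le_of_forall_mem_sphere_norm_le (e 1) hR
      ((hh'.comp (f := fun x₂ => (x₁, x₂)) (s := closedBall 0 R) (by fun_prop)
        fun x₂ hx₂ => ⟨ball_subset_closedBall hx₁, hx₂⟩).diffContOnCl_ball subset_rfl)
      (fun z hz => hM _ ⟨ball_subset_closedBall hx₁, sphere_subset_closedBall hz⟩)
  -- The radius is halved in the first variable because the inner derivative is known to be
  -- holomorphic only on the open ball.
  have hsub : closedBall (0 : ℂ) (R / 2) ⊆ ball 0 R := closedBall_subset_ball (by linarith)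
  have hout := Complex.norm_iteratedDeriv_le_of_forall_mem_sphere_norm_le (c := 0) (R := R / 2)
    (e 0) (by positivity)
    (((differentiableOn_iteratedDeriv_snd hR hh' hM (e 1)).mono hsub).diffContOnCl_ball subset_rfl)
    (fun z hz => hin z (hsub (sphere_subset_closedBall hz)))
  change ‖iteratedDeriv (e 0) (fun x₁ => iteratedDeriv (e 1) (fun x₂ => h (x₁, x₂)) 0) 0 /
    (((e 0).factorial : ℂ) * ((e 1).factorial : ℂ))‖ ≤ _
  rw [norm_div, norm_mul, Complex.norm_natCast, Complex.norm_natCast]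
  have h0 : (0 : ℝ) < (e 0).factorial := by exact_mod_cast (e 0).factorial_pos
  have h1 : (0 : ℝ) < (e 1).factorial := by exact_mod_cast (e 1).factorial_pos
  have hpow : (R ^ e 1)⁻¹ ≤ ((R / 2) ^ e 1)⁻¹ := by gcongr; linarith
  calc _ ≤ (e 0).factorial * ((e 1).factorial * M / R ^ e 1) / (R / 2) ^ e 0 /
        ((e 0).factorial * (e 1).factorial) := by gcongr
    _ = M * (((R / 2) ^ e 0)⁻¹ * (R ^ e 1)⁻¹) := by field_simp
    _ ≤ M * (((R / 2) ^ e 0)⁻¹ * ((R / 2) ^ e 1)⁻¹) := by gcongr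
    _ = _ := by rw [pow_add, mul_inv]

end MonomialSummability

/-! ### The differential equation in the Borel plane, uniformly in the parameter `lam` -/

namespace MonomialSummability

open Set Metric Filter Topology

variable {E : Type*} [NormedAddCommGroup E] [NormedSpace ℂ E]

/-- A convex domain of the Borel plane containing the origin and avoiding a cone around the ray
from `μ` to infinity. The constant `c` governs the weights `exp (-(lam * c) / (1 + ‖ξ‖))`. -/
structure IsBorelDomain (Ω : Set ℂ) (δ c : ℝ) (μ : ℂ) : Prop where
  isOpen : IsOpen Ω
  convex : Convex ℝ Ω
  zero_mem : (0 : ℂ) ∈ Ω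
  pos : 0 < δ
  le_norm_sub : ∀ ξ ∈ Ω, δ * (1 + ‖ξ‖) ≤ ‖μ - ξ‖
  mem_slitPlane : ∀ ξ ∈ Ω, 1 - ξ / μ ∈ Complex.slitPlane
  le_mul : ‖μ‖ + 1 ≤ c * δ

/-- The weight controlling the loss of radius of convergence in the Borel plane. -/
noncomputable def borelWeight (c lam : ℝ) (ξ : ℂ) : ℝ := Real.exp (-(lam * c) / (1 + ‖ξ‖))

theorem borelWeight_pos (c lam : ℝ) (ξ : ℂ) : 0 < borelWeight c lam ξ := Real.exp_pos _

theorem norm_exp_mul_log (a : ℝ) (z : ℂ) :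
    ‖Complex.exp (a * Complex.log z)‖ = Real.exp (a * Real.log ‖z‖) := by
  rw [Complex.norm_exp, Complex.re_ofReal_mul, Complex.log_re]

namespace IsBorelDomain

variable {Ω : Set ℂ} {δ c : ℝ} {μ : ℂ}

theorem sub_ne_zero (h : IsBorelDomain Ω δ c μ) {ξ : ℂ} (hξ : ξ ∈ Ω) : μ - ξ ≠ 0 := by
  have := h.le_norm_sub ξ hξ
  have := h.pos
  rw [← norm_pos_iff]
  have : 0 < δ * (1 + ‖ξ‖) := by positivity
  linarith

theorem ne_zero (h : IsBorelDomain Ω δ c μ) : μ ≠ 0 := by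
  simpa using h.sub_ne_zero h.zero_mem

theorem smul_mem (h : IsBorelDomain Ω δ c μ) {ξ : ℂ} (hξ : ξ ∈ Ω) {τ : ℝ} (h0 : 0 ≤ τ)
    (h1 : τ ≤ 1) : (τ : ℂ) * ξ ∈ Ω := by
  simpa using h.convex.smul_mem_of_zero_mem h.zero_mem hξ ⟨h0, h1⟩

theorem c_pos (h : IsBorelDomain Ω δ c μ) : 0 < c := by
  have h1 := h.le_mul
  have h2 := h.pos
  have : 0 < c * δ := by linarith [norm_nonneg μ]
  exact pos_of_mul_pos_left this h2.le

/-- The vector (1 + |ξ|)(μ - τξ) differs from (1 + τ|ξ|)(μ - ξ) by (1 - τ)(|ξ|μ + ξ). By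
`le_norm_sub` and `le_mul` the relative size of this error is at most the exponent on the right, and
1 + x ≤ exp x concludes. -/
theorem norm_sub_smul_mul_le (h : IsBorelDomain Ω δ c μ) {ξ : ℂ} (hξ : ξ ∈ Ω) {τ : ℝ} (h0 : 0 ≤ τ)
    (h1 : τ ≤ 1) : ‖μ - τ * ξ‖ * (1 + ‖ξ‖) ≤
      ‖μ - ξ‖ * (1 + τ * ‖ξ‖) * Real.exp (c / (1 + τ * ‖ξ‖) - c / (1 + ‖ξ‖)) := by
  have hr : 0 ≤ ‖ξ‖ := norm_nonneg ξ
  have hc := h.c_pos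
  have hp1 : 0 < 1 + τ * ‖ξ‖ := by positivity
  have hp2 : 0 < 1 + ‖ξ‖ := by positivity
  have e1 : ((1 + ‖ξ‖ : ℝ) : ℂ) * (μ - τ * ξ) = ((1 + τ * ‖ξ‖ : ℝ) : ℂ) * (μ - ξ) +
      ((1 - τ : ℝ) : ℂ) * ((‖ξ‖ : ℂ) * μ + ξ) := by push_cast; ring
  have e2 : ‖μ - τ * ξ‖ * (1 + ‖ξ‖) ≤ ‖μ - ξ‖ * (1 + τ * ‖ξ‖) + (1 - τ) * (‖ξ‖ * (‖μ‖ + 1)) := by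
    have := congrArg norm e1
    rw [norm_mul, Complex.norm_real, Real.norm_of_nonneg hp2.le] at this
    rw [mul_comm, this]
    refine (norm_add_le _ _).trans ?_
    rw [norm_mul, norm_mul, Complex.norm_real, Complex.norm_real, Real.norm_of_nonneg hp1.le,
      Real.norm_of_nonneg (by linarith : (0 : ℝ) ≤ 1 - τ), mul_comm ‖μ - ξ‖]
    gcongr
    refine (norm_add_le _ _).trans ?_
    rw [norm_mul, Complex.norm_real, Real.norm_of_nonneg hr]
    linarith
  have e3 : c / (1 + τ * ‖ξ‖) - c / (1 + ‖ξ‖) =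
      c * ((1 - τ) * ‖ξ‖) / ((1 + τ * ‖ξ‖) * (1 + ‖ξ‖)) := by field_simp; ring
  have e4 := Real.add_one_le_exp (c / (1 + τ * ‖ξ‖) - c / (1 + ‖ξ‖))
  have e5 : (1 - τ) * (‖ξ‖ * (‖μ‖ + 1)) ≤ ‖μ - ξ‖ * (c * ((1 - τ) * ‖ξ‖) / (1 + ‖ξ‖)) := by
    have h1τ : 0 ≤ 1 - τ := by linarith
    calc (1 - τ) * (‖ξ‖ * (‖μ‖ + 1)) ≤ (1 - τ) * (‖ξ‖ * (c * δ)) := by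
          gcongr; exact h.le_mul
      _ = (δ * (1 + ‖ξ‖)) * (c * ((1 - τ) * ‖ξ‖) / (1 + ‖ξ‖)) := by field_simp
      _ ≤ _ := by gcongr; exact h.le_norm_sub ξ hξ
  calc _ ≤ ‖μ - ξ‖ * (1 + τ * ‖ξ‖) + ‖μ - ξ‖ * (c * ((1 - τ) * ‖ξ‖) / (1 + ‖ξ‖)) := by linarith
    _ = ‖μ - ξ‖ * (1 + τ * ‖ξ‖) * (c / (1 + τ * ‖ξ‖) - c / (1 + ‖ξ‖) + 1) := by
        rw [e3]; field_simp; ring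
    _ ≤ _ := by gcongr

/-- On the segment from 0 to ξ, the function log|1 - η/μ| - c/(1 + |η|) - log(1 + |η|) is largest at
the endpoint ξ. The term c/(1 + |η|) is the exponent of `borelWeight`; it repairs the possible
failure of this maximality for log|1 - η/μ| - log(1 + |η|) alone. -/
theorem log_norm_le (h : IsBorelDomain Ω δ c μ) {ξ : ℂ} (hξ : ξ ∈ Ω) {τ : ℝ} (h0 : 0 ≤ τ)
    (h1 : τ ≤ 1) : Real.log ‖1 - τ * ξ / μ‖ - c / (1 + τ * ‖ξ‖) ≤
      Real.log ‖1 - ξ / μ‖ - c / (1 + ‖ξ‖) - Real.log (1 + ‖ξ‖) + Real.log (1 + τ * ‖ξ‖) := by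
  have hp1 : 0 < 1 + τ * ‖ξ‖ := by positivity
  have hp2 : 0 < 1 + ‖ξ‖ := by positivity
  have hμ := norm_pos_iff.2 h.ne_zero
  have hn : ∀ η ∈ Ω, 0 < ‖μ - η‖ := fun η hη => norm_pos_iff.2 (h.sub_ne_zero hη)
  have hlog : ∀ η ∈ Ω, Real.log ‖1 - η / μ‖ = Real.log ‖μ - η‖ - Real.log ‖μ‖ := by
    intro η hη
    rw [← Real.log_div (hn η hη).ne' hμ.ne', ← norm_div, sub_div, div_self h.ne_zero]
  have hτ := h.smul_mem hξ h0 h1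
  rw [hlog _ hξ, hlog _ hτ]
  have := Real.log_le_log (by have := hn _ hτ; positivity) (h.norm_sub_smul_mul_le hξ h0 h1)
  rw [Real.log_mul (hn _ hτ).ne' hp2.ne', Real.log_mul (by have := hn _ hξ; positivity)
    (Real.exp_pos _).ne', Real.log_exp, Real.log_mul (hn _ hξ).ne' hp1.ne'] at this
  linarith

theorem hasDerivAt_log (h : IsBorelDomain Ω δ c μ) {ξ : ℂ} (hξ : ξ ∈ Ω) :
    HasDerivAt (fun z : ℂ => Complex.log (1 - z / μ)) (-(μ - ξ)⁻¹) ξ := by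
  have h1 : HasDerivAt (fun z : ℂ => 1 - z / μ) (-(1 / μ)) ξ :=
    ((hasDerivAt_id ξ).div_const μ).const_sub 1
  convert h1.clog (h.mem_slitPlane ξ hξ) using 1
  have := h.sub_ne_zero hξ
  have h2 := h.ne_zero
  have h3 : 1 - ξ / μ = (μ - ξ) / μ := by field_simp
  rw [h3]
  field_simp

theorem hasDerivAt_exp_log (h : IsBorelDomain Ω δ c μ) (a : ℂ) {ξ : ℂ} (hξ : ξ ∈ Ω) :
    HasDerivAt (fun z : ℂ => Complex.exp (a * Complex.log (1 - z / μ)))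
      (-(Complex.exp (a * Complex.log (1 - ξ / μ)) * (a * (μ - ξ)⁻¹))) ξ := by
  rw [← mul_neg, ← mul_neg]
  exact ((h.hasDerivAt_log hξ).const_mul a).cexp

/-- Uniqueness for the homogeneous scalar equation. -/
theorem eq_zero_of_deriv (h : IsBorelDomain Ω δ c μ) {a : ℂ} {v : ℂ → E}
    (hv : DifferentiableOn ℂ v Ω) (hv0 : v 0 = 0)
    (heq : ∀ ξ ∈ Ω, (μ - ξ) • deriv v ξ = a • v ξ) : ∀ ξ ∈ Ω, v ξ = 0 := by
  intro ξ hξ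
  have hd : ∀ ξ ∈ Ω, HasDerivAt (fun z => Complex.exp (a * Complex.log (1 - z / μ)) • v z) 0 ξ := by
    intro ξ hξ
    have h1 := (h.hasDerivAt_exp_log a hξ).fun_smul
      (hv.differentiableAt (h.isOpen.mem_nhds hξ)).hasDerivAt
    convert h1 using 1
    have h2 : deriv v ξ = (μ - ξ)⁻¹ • a • v ξ := by
      rw [← heq ξ hξ, smul_smul, inv_mul_cancel₀ (h.sub_ne_zero hξ), one_smul]
    rw [h2, smul_smul, smul_smul, ← add_smul]
    convert (zero_smul ℂ (v ξ)).symm using 2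
    ring
  have := h.isOpen.is_const_of_deriv_eq_zero h.convex.isPreconnected
    (fun z hz => (hd z hz).differentiableAt.differentiableWithinAt)
    (fun z hz => (hd z hz).deriv) hξ h.zero_mem
  simp only [hv0, smul_zero, smul_eq_zero, Complex.exp_ne_zero, false_or] at this
  exact this

/-- The inhomogeneous scalar equation `(μ - ξ) u' = lam u + H`, with a bound uniform in `lam`. -/
theorem exists_scalar_solution [CompleteSpace E] (h : IsBorelDomain Ω δ c μ) {lam : ℝ}
    (hlam : 0 ≤ lam) {H : ℂ → E} (hH : DifferentiableOn ℂ H Ω) :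
    ∃ u : ℂ → E, u 0 = 0 ∧ DifferentiableOn ℂ u Ω ∧
      (∀ ξ ∈ Ω, (μ - ξ) • deriv u ξ = (lam : ℂ) • u ξ + H ξ) ∧
      ∀ M : ℝ, (∀ ξ ∈ Ω, ‖H ξ‖ ≤ M * borelWeight c lam ξ) →
        ∀ ξ ∈ Ω, ‖deriv u ξ‖ ≤ (1 + δ⁻¹) * δ⁻¹ * M * borelWeight c lam ξ := by
  have hδ := h.pos
  -- Variation of constants: the solution is (1 - z/μ)^(-lam) G, where G is the primitive of (1 -
  -- z/μ)^lam (μ - z)⁻¹ H vanishing at 0.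
  let e : ℂ → ℂ := fun z => Complex.exp (lam * Complex.log (1 - z / μ))
  have hgd : DifferentiableOn ℂ (fun z => (e z * (μ - z)⁻¹) • H z) Ω := by
    intro z hz
    have h1 : DifferentiableAt ℂ e z := (h.hasDerivAt_exp_log lam hz).differentiableAt
    have h2 := h.sub_ne_zero hz
    have h3 : DifferentiableAt ℂ (fun z : ℂ => (μ - z)⁻¹) z :=
      DifferentiableAt.inv (by fun_prop) h2
    exact ((h1.mul h3).differentiableWithinAt).smul (hH z hz)
  obtain ⟨G₀, hG₀⟩ := h.convex.exists_forall_hasDerivWithinAt hgd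
  let G : ℂ → E := fun z => G₀ z - G₀ 0
  have hG : ∀ z ∈ Ω, HasDerivAt G ((e z * (μ - z)⁻¹) • H z) z := fun z hz =>
    ((hG₀ z hz).hasDerivAt (h.isOpen.mem_nhds hz)).sub_const _
  let e' : ℂ → ℂ := fun z => Complex.exp (((-lam : ℝ) : ℂ) * Complex.log (1 - z / μ))
  have hee : ∀ z, e' z * e z = 1 := fun z => by
    simp only [e, e', ← Complex.exp_add]
    rw [← Complex.exp_zero]; congr 1; push_cast; ring
  have hud : ∀ z ∈ Ω, HasDerivAt (fun z => e' z • G z)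
      ((μ - z)⁻¹ • ((lam : ℂ) • (e' z • G z) + H z)) z := by
    intro z hz
    convert (h.hasDerivAt_exp_log ((-lam : ℝ) : ℂ) hz).fun_smul (hG z hz) using 1
    rw [smul_add, smul_smul, smul_smul, smul_smul, add_comm, ← mul_assoc, hee, one_mul]
    congr 2
    change _ = -(e' z * (((-lam : ℝ) : ℂ) * (μ - z)⁻¹))
    push_cast
    ring
  refine ⟨fun z => e' z • G z, by simp [G], fun z hz =>
    (hud z hz).differentiableAt.differentiableWithinAt, fun z hz => ?_, fun M hM z hz => ?_⟩
  · rw [(hud z hz).deriv, smul_smul, mul_inv_cancel₀ (h.sub_ne_zero hz), one_smul]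
  · have hM0 : 0 ≤ M := by
      have := (norm_nonneg _).trans (hM z hz)
      exact nonneg_of_mul_nonneg_left this (borelWeight_pos _ _ _)
    rw [(hud z hz).deriv, norm_smul, norm_inv]
    set r := ‖z‖ with hr
    have hr0 : 0 ≤ r := norm_nonneg z
    let κ : ℝ := Real.log ‖1 - z / μ‖ - c / (1 + r) - Real.log (1 + r)
    -- The product lam G is estimated, not G: along the segment from 0 to z the norm of its
    -- derivative is at most the derivative of M δ⁻¹ exp(lam (κ + log(1 + τ r))), which itself
    -- carries the factor lam. The constant is therefore independent of lam.
    have hGbound : ‖(lam : ℂ) • G z‖ ≤ M * δ⁻¹ * Real.exp (lam * (κ + Real.log (1 + r))) := by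
      have hmem : ∀ τ : ℝ, τ ∈ Icc (0 : ℝ) 1 → (τ : ℂ) * z ∈ Ω := fun τ hτ =>
        h.smul_mem hz hτ.1 hτ.2
      have hf : ∀ τ ∈ Icc (0 : ℝ) 1, HasDerivAt (fun τ : ℝ => (lam : ℂ) • G (τ * z))
          ((lam : ℂ) • (z • ((e (τ * z) * (μ - τ * z)⁻¹) • H (τ * z)))) τ := by
        intro τ hτ
        have h1 : HasDerivAt (fun τ : ℝ => (τ : ℂ) * z) z τ := by
          simpa using (Complex.ofRealCLM.hasDerivAt (x := τ)).mul_const z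
        exact ((hG _ (hmem τ hτ)).scomp τ h1).const_smul (lam : ℂ)
      have hB : ∀ τ ∈ Icc (0 : ℝ) 1, HasDerivAt
          (fun τ : ℝ => M * δ⁻¹ * Real.exp (lam * (κ + Real.log (1 + τ * r))))
          (M * δ⁻¹ * (Real.exp (lam * (κ + Real.log (1 + τ * r))) * (lam * (r / (1 + τ * r))))) τ := by
        intro τ hτ
        have hpos : 0 < 1 + τ * r := by have := hτ.1; positivity
        have h1 : HasDerivAt (fun τ : ℝ => 1 + τ * r) r τ := by
          simpa using ((hasDerivAt_id τ).mul_const r).const_add 1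
        exact ((((h1.log hpos.ne').const_add κ).const_mul lam).exp).const_mul (M * δ⁻¹)
      have := image_norm_le_of_norm_deriv_right_le_deriv_boundary'
        (fun τ hτ => (hf τ hτ).continuousAt.continuousWithinAt)
        (fun τ hτ => (hf τ (Ico_subset_Icc_self hτ)).hasDerivWithinAt) (a := 0) (b := 1)
        (B := fun τ : ℝ => M * δ⁻¹ * Real.exp (lam * (κ + Real.log (1 + τ * r))))
        (by simp only [G, Complex.ofReal_zero, zero_mul, sub_self, smul_zero, norm_zero]
            positivity)
        (fun τ hτ => (hB τ hτ).continuousAt.continuousWithinAt)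
        (fun τ hτ => (hB τ (Ico_subset_Icc_self hτ)).hasDerivWithinAt) ?_
        (right_mem_Icc.2 zero_le_one)
      · simpa using this
      · intro τ hτ
        have hτ' := Ico_subset_Icc_self hτ
        have hpos : 0 < 1 + τ * r := by have := hτ.1; positivity
        have hnτ : ‖(τ : ℂ) * z‖ = τ * r := by
          rw [norm_mul, Complex.norm_real, Real.norm_of_nonneg hτ.1]
        rw [norm_smul, norm_smul, norm_smul, norm_mul, norm_inv, Complex.norm_real,
          Real.norm_of_nonneg hlam, norm_exp_mul_log, ← hr]
        have hH' := hM _ (hmem τ hτ')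
        rw [borelWeight, hnτ] at hH'
        have hdist := h.le_norm_sub _ (hmem τ hτ')
        rw [hnτ] at hdist
        have hlog := h.log_norm_le hz hτ.1 hτ'.2
        have hinv : ‖μ - τ * z‖⁻¹ ≤ (δ * (1 + τ * r))⁻¹ := by gcongr
        calc lam * (r * (Real.exp (lam * Real.log ‖1 - τ * z / μ‖) * ‖μ - τ * z‖⁻¹ *
                ‖H (τ * z)‖))
            ≤ lam * (r * (Real.exp (lam * Real.log ‖1 - τ * z / μ‖) * (δ * (1 + τ * r))⁻¹ *
                (M * Real.exp (-(lam * c) / (1 + τ * r))))) := by gcongr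
          _ = M * δ⁻¹ * (Real.exp (lam * (Real.log ‖1 - τ * z / μ‖ - c / (1 + τ * r))) *
                (lam * (r / (1 + τ * r)))) := by
              rw [mul_sub, Real.exp_sub, neg_div, mul_div_assoc, Real.exp_neg, mul_inv]
              ring_nf
          _ ≤ _ := by
              gcongr
    have hu : ‖(lam : ℂ) • (e' z • G z)‖ ≤ M * δ⁻¹ * borelWeight c lam z := by
      rw [smul_comm, norm_smul, norm_exp_mul_log]
      calc _ ≤ Real.exp (-lam * Real.log ‖1 - z / μ‖) *
            (M * δ⁻¹ * Real.exp (lam * (κ + Real.log (1 + r)))) := by gcongr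
        _ = M * δ⁻¹ * Real.exp (-lam * Real.log ‖1 - z / μ‖ + lam * (κ + Real.log (1 + r))) := by
            rw [Real.exp_add]; ring
        _ = _ := by
            rw [borelWeight]; congr 2; simp only [κ, ← hr]; ring
    have hinv : ‖μ - z‖⁻¹ ≤ δ⁻¹ := by
      have := h.le_norm_sub z hz
      gcongr
      nlinarith
    have hw := borelWeight_pos c lam z
    calc ‖μ - z‖⁻¹ * ‖(lam : ℂ) • (e' z • G z) + H z‖
        ≤ δ⁻¹ * (M * δ⁻¹ * borelWeight c lam z + M * borelWeight c lam z) := by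
          gcongr
          exact (norm_add_le _ _).trans (add_le_add hu (hM z hz))
      _ = _ := by ring

end IsBorelDomain

/-- Solution of `(A - ξ) u' = lam u + H` for an operator annihilated by `∏ (A - μ)`, with a bound
uniform in `lam`. -/
theorem exists_solution_of_list [CompleteSpace E] (A : E →L[ℂ] E) {Ω : Set ℂ} {δ c : ℝ}
    (hO : IsOpen Ω) (L : List ℂ)
    (hL : ∀ μ ∈ L, IsBorelDomain Ω δ c μ) : ∃ K : ℝ, 0 ≤ K ∧ ∀ lam : ℝ, 0 ≤ lam → ∀ H : ℂ → E,
      DifferentiableOn ℂ H Ω →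
      (∀ ξ ∈ Ω, (L.map fun μ => A - μ • (1 : E →L[ℂ] E)).prod (H ξ) = 0) →
      ∃ u : ℂ → E, u 0 = 0 ∧ DifferentiableOn ℂ u Ω ∧
        (∀ ξ ∈ Ω, A (deriv u ξ) - ξ • deriv u ξ = (lam : ℂ) • u ξ + H ξ) ∧
        ∀ M : ℝ, (∀ ξ ∈ Ω, ‖H ξ‖ ≤ M * borelWeight c lam ξ) →
          ∀ ξ ∈ Ω, ‖deriv u ξ‖ ≤ K * M * borelWeight c lam ξ := by
  induction L with
  | nil =>
    refine ⟨0, le_rfl, fun lam _ H _ hH0 => ⟨0, rfl, differentiableOn_const _, fun ξ hξ => ?_,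
      fun M _ ξ _ => ?_⟩⟩
    · have : H ξ = 0 := by simpa using hH0 ξ hξ
      simp [this]
    · simp
  | cons μ L ih =>
    obtain ⟨K, hK, hsol⟩ := ih fun ν hν => hL ν (List.mem_cons_of_mem _ hν)
    have hμ : IsBorelDomain Ω δ c μ := hL μ List.mem_cons_self
    have hδ := hμ.pos
    set T : E →L[ℂ] E := A - μ • (1 : E →L[ℂ] E) with hT
    have hTa : ∀ x, T x = A x - μ • x := fun x => by simp [hT]
    refine ⟨(1 + δ⁻¹) * δ⁻¹ * (1 + K * ‖T‖), by positivity, fun lam hlam H hH hH0 => ?_⟩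
    have hcomm : Commute T (L.map fun μ => A - μ • (1 : E →L[ℂ] E)).prod := by
      refine Commute.list_prod_right _ _ fun S hS => ?_
      obtain ⟨ν, -, rfl⟩ := List.mem_map.1 hS
      refine (((Commute.refl A).sub_left ?_).sub_right (Commute.sub_left ?_ ?_))
      · exact (Commute.one_left A).smul_left μ
      · exact (Commute.one_right A).smul_right ν
      · exact ((Commute.one_right _).smul_right ν)
    -- The function w is the candidate for T u: it solves the equation with source T H, which the
    -- remaining factors annihilate. Then u comes from a scalar equation with source H - w'.
    obtain ⟨w, hw0, hwd, hweq, hwb⟩ := hsol lam hlam (fun ξ => T (H ξ))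
      (T.differentiable.comp_differentiableOn hH) (fun ξ hξ => by
        have := hH0 ξ hξ
        rw [List.map_cons, List.prod_cons, hcomm.eq] at this
        exact this)
    obtain ⟨u, hu0, hud, hueq, hub⟩ := hμ.exists_scalar_solution hlam
      (hH.sub (hwd.deriv hO))
    have huA : ∀ ξ ∈ Ω, HasDerivAt u (deriv u ξ) ξ := fun ξ hξ =>
      (hud.differentiableAt (hO.mem_nhds hξ)).hasDerivAt
    have hwA : ∀ ξ ∈ Ω, HasDerivAt w (deriv w ξ) ξ := fun ξ hξ =>
      (hwd.differentiableAt (hO.mem_nhds hξ)).hasDerivAt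
    have hvA : ∀ ξ ∈ Ω, HasDerivAt (fun z => T (u z) - w z) (T (deriv u ξ) - deriv w ξ) ξ :=
      fun ξ hξ => (T.hasFDerivAt.comp_hasDerivAt ξ (huA ξ hξ)).sub (hwA ξ hξ)
    -- The two equations make T u - w a solution of the homogeneous scalar equation with value 0 at
    -- the origin. Hence T u' = w', which turns the scalar equation for u into the equation for A.
    have hv : ∀ ξ ∈ Ω, T (u ξ) - w ξ = 0 := by
      refine hμ.eq_zero_of_deriv (a := lam)
        (fun ξ hξ => (hvA ξ hξ).differentiableAt.differentiableWithinAt) (by simp [hu0, hw0])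
        fun ξ hξ => ?_
      rw [(hvA ξ hξ).deriv, smul_sub, ← map_smul, hueq ξ hξ]
      have h1 := hweq ξ hξ
      have h2 : (μ - ξ) • deriv w ξ = (lam : ℂ) • w ξ + T (H ξ) - T (deriv w ξ) := by
        rw [← h1, hTa, sub_smul]; abel
      rw [h2, Pi.sub_apply, map_add, map_sub, map_smul, smul_sub]
      abel
    have hTu : ∀ ξ ∈ Ω, T (deriv u ξ) = deriv w ξ := by
      intro ξ hξ
      have h1 : (fun z => T (u z) - w z) =ᶠ[𝓝 ξ] fun _ => 0 := by
        filter_upwards [hO.mem_nhds hξ] with z hz using hv z hz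
      have h2 := h1.deriv_eq
      rw [(hvA ξ hξ).deriv, deriv_const] at h2
      exact sub_eq_zero.1 h2
    refine ⟨u, hu0, hud, fun ξ hξ => ?_, fun M hM ξ hξ => ?_⟩
    · have h1 := hueq ξ hξ
      have h2 := hTu ξ hξ
      rw [hTa] at h2
      rw [Pi.sub_apply, sub_smul] at h1
      calc A (deriv u ξ) - ξ • deriv u ξ
          = (A (deriv u ξ) - μ • deriv u ξ) + (μ • deriv u ξ - ξ • deriv u ξ) := by abel
        _ = _ := by rw [h2, h1]; abel
    · have h1 : ∀ ξ ∈ Ω, ‖T (H ξ)‖ ≤ ‖T‖ * M * borelWeight c lam ξ := fun ξ hξ =>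
        (T.le_opNorm _).trans (by rw [mul_assoc]; gcongr; exact hM ξ hξ)
      have h2 := hwb _ h1
      have h3 := hub (M + K * (‖T‖ * M)) (fun ξ hξ => by
        rw [add_mul]
        exact (norm_sub_le _ _).trans (add_le_add (hM ξ hξ) (h2 ξ hξ))) ξ hξ
      refine h3.trans (le_of_eq ?_)
      ring

end MonomialSummability

/-! ### Recursion over the exponents and geometric bounds for the Borel transforms -/

namespace MonomialSummability

open Set Metric Filter Topology

variable {E : Type*} [NormedAddCommGroup E] [NormedSpace ℂ E]

/-- The total degree of a bivariate exponent. -/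
def bideg (k : Fin 2 →₀ ℕ) : ℕ := k 0 + k 1

theorem bideg_add (j k : Fin 2 →₀ ℕ) : bideg (j + k) = bideg j + bideg k := by
  simp [bideg]; ring

theorem bideg_pos {k : Fin 2 →₀ ℕ} (hk : k ≠ 0) : 0 < bideg k := by
  by_contra h
  apply hk
  ext i
  simp only [bideg] at h
  fin_cases i <;> simp <;> omega

theorem summable_pow_bideg {x : ℝ} (h0 : 0 ≤ x) (h1 : x < 1) :
    Summable fun k : Fin 2 →₀ ℕ => x ^ bideg k := by
  have hg := summable_geometric_of_lt_one h0 h1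
  have h2 : Summable fun k : ℕ × ℕ => x ^ k.1 * x ^ k.2 :=
    hg.mul_of_nonneg hg (fun n => by positivity) fun n => by positivity
  refine ((Finsupp.equivFunOnFinite.trans (finTwoArrowEquiv ℕ)).summable_iff.2 h2).congr fun k => ?_
  simp [bideg, pow_add]

theorem sum_antidiagonal_fst_le_tsum {f : (Fin 2 →₀ ℕ) → ℝ} (hf : Summable f) (h0 : ∀ k, 0 ≤ f k)
    (k : Fin 2 →₀ ℕ) : ∑ x ∈ Finset.HasAntidiagonal.antidiagonal k, f x.1 ≤ ∑' j, f j := by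
  have hinj : Set.InjOn Prod.fst (Finset.HasAntidiagonal.antidiagonal k : Set ((Fin 2 →₀ ℕ) × (Fin 2 →₀ ℕ))) := by
    intro x hx y hy hxy
    have h1 : x.1 + x.2 = k := Finset.HasAntidiagonal.mem_antidiagonal.1 hx
    have h2 : y.1 + y.2 = k := Finset.HasAntidiagonal.mem_antidiagonal.1 hy
    refine Prod.ext hxy ?_
    rw [hxy, ← h2] at h1
    exact add_left_cancel h1
  rw [← Finset.sum_image (f := f) hinj]
  exact hf.sum_le_tsum _ fun i _ => h0 i

theorem sum_antidiagonal_eq_add {M : Type*} [AddCommMonoid M] (k : Fin 2 →₀ ℕ)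
    (f : (Fin 2 →₀ ℕ) × (Fin 2 →₀ ℕ) → M) :
    ∑ x ∈ Finset.HasAntidiagonal.antidiagonal k, f x =
      f (0, k) + ∑ x ∈ Finset.HasAntidiagonal.antidiagonal k with x.1 ≠ 0, f x := by
  rw [← Finset.sum_filter_add_sum_filter_not _ (fun x => x.1 = 0)]
  congr 1
  have : (Finset.HasAntidiagonal.antidiagonal k).filter (fun x => x.1 = 0) = {(0, k)} := by
    ext ⟨a, b⟩
    simp only [Finset.mem_filter, Finset.HasAntidiagonal.mem_antidiagonal, Finset.mem_singleton, Prod.mk.injEq]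
    constructor
    · rintro ⟨h1, h2⟩
      subst h2
      simpa using h1
    · rintro ⟨rfl, rfl⟩
      simp
  rw [this, Finset.sum_singleton]

theorem borelWeight_le_one {b lam : ℝ} (hb : 0 ≤ b) (hlam : 0 ≤ lam) (ξ : ℂ) :
    borelWeight b lam ξ ≤ 1 := by
  rw [borelWeight, Real.exp_le_one_iff, neg_div, neg_nonpos]
  positivity

/-- The weight is multiplicative in `lam` and is at least exp(-b lam) everywhere, so passing to a
larger parameter costs only a factor geometric in the degree. -/
theorem borelWeight_le {b lam lam' : ℝ} {n : ℕ} (hb : 0 ≤ b) (hn : lam ≤ n)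
    (ξ : ℂ) : borelWeight b lam' ξ ≤ Real.exp b ^ n * borelWeight b (lam + lam') ξ := by
  rw [borelWeight, borelWeight, ← Real.exp_nat_mul, ← Real.exp_add, Real.exp_le_exp]
  have h1 : lam * b / (1 + ‖ξ‖) ≤ n * b := by
    rw [div_le_iff₀ (by positivity)]
    have : lam * b ≤ n * b := by gcongr
    nlinarith [norm_nonneg ξ, mul_nonneg (n.cast_nonneg (α := ℝ)) hb]
  have h2 : -((lam + lam') * b) / (1 + ‖ξ‖) =
      -(lam' * b) / (1 + ‖ξ‖) - lam * b / (1 + ‖ξ‖) := by ring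
  linarith

/-- Solution of the equation in the Borel plane, coefficient by coefficient in `x₁, x₂`, on a common
domain and with geometric bounds. -/
theorem exists_borel_family [CompleteSpace E] {Ω : Set ℂ} {δ b : ℝ} (hO : IsOpen Ω) (hb : 0 ≤ b)
    (C : (Fin 2 →₀ ℕ) → E →L[ℂ] E) (L : List ℂ) (hL : ∀ μ ∈ L, IsBorelDomain Ω δ b μ)
    (hprod : (L.map fun μ => C 0 - μ • (1 : E →L[ℂ] E)).prod = 0)
    (lam : (Fin 2 →₀ ℕ) → ℝ) (hlam0 : ∀ k, 0 ≤ lam k) (hlam : ∀ k, lam k ≤ bideg k)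
    (hadd : ∀ j k, lam (j + k) = lam j + lam k) (g : (Fin 2 →₀ ℕ) → E) {A q : ℝ} (hA : 0 ≤ A)
    (hq : 0 < q) (hC : ∀ k, ‖C k‖ ≤ A * q ^ bideg k) (hg : ∀ k, ‖g k‖ ≤ A * q ^ bideg k) :
    ∃ (u : (Fin 2 →₀ ℕ) → ℂ → E) (M Q : ℝ), 0 ≤ M ∧ 0 < Q ∧ q ≤ Q ∧ ∀ k,
      u k 0 = 0 ∧ DifferentiableOn ℂ (u k) Ω ∧
      (∀ ξ ∈ Ω, ∑ x ∈ Finset.HasAntidiagonal.antidiagonal k, C x.1 (deriv (u x.2) ξ) - ξ • deriv (u k) ξ =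
        (lam k : ℂ) • u k ξ + g k) ∧
      ∀ ξ ∈ Ω, ‖deriv (u k) ξ‖ ≤ M * Q ^ bideg k := by
  obtain ⟨K, hK, hsol⟩ := exists_solution_of_list (C 0) hO L hL
  -- The solution operator is made total, with a junk value for nonholomorphic H, so that the
  -- recursion can be run before holomorphy is known.
  have hsol' : ∀ (k : Fin 2 →₀ ℕ) (H : ℂ → E), ∃ u : ℂ → E, DifferentiableOn ℂ H Ω →
      u 0 = 0 ∧ DifferentiableOn ℂ u Ω ∧
        (∀ ξ ∈ Ω, C 0 (deriv u ξ) - ξ • deriv u ξ = (lam k : ℂ) • u ξ + H ξ) ∧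
        ∀ M : ℝ, (∀ ξ ∈ Ω, ‖H ξ‖ ≤ M * borelWeight b (lam k) ξ) →
          ∀ ξ ∈ Ω, ‖deriv u ξ‖ ≤ K * M * borelWeight b (lam k) ξ := by
    intro k H
    by_cases hH : DifferentiableOn ℂ H Ω
    · obtain ⟨u, hu⟩ := hsol (lam k) (hlam0 k) H hH (fun ξ _ => by rw [hprod]; rfl)
      exact ⟨u, fun _ => hu⟩
    · exact ⟨0, fun h => absurd h hH⟩
  choose S hS using hsol'
  have hdec : ∀ {k : Fin 2 →₀ ℕ} {x : (Fin 2 →₀ ℕ) × (Fin 2 →₀ ℕ)},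
      x ∈ Finset.HasAntidiagonal.antidiagonal k → x.1 ≠ 0 → bideg x.2 < bideg k := by
    intro k x hx hx0
    rw [← Finset.HasAntidiagonal.mem_antidiagonal.1 hx, bideg_add]
    have := bideg_pos hx0
    omega
  obtain ⟨u, hu⟩ : ∃ u : (Fin 2 →₀ ℕ) → ℂ → E, ∀ k, u k = S k (fun ξ => g k -
      ∑ x ∈ Finset.HasAntidiagonal.antidiagonal k with x.1 ≠ 0, C x.1 (deriv (u x.2) ξ)) := by
    classical
    let Φ : ∀ k, (∀ j, bideg j < bideg k → ℂ → E) → ℂ → E := fun k rec => S k (fun ξ => g k -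
      ∑ x ∈ Finset.HasAntidiagonal.antidiagonal k with x.1 ≠ 0,
        C x.1 (if h : bideg x.2 < bideg k then deriv (rec x.2 h) ξ else 0))
    -- Terms with x.1 ≠ 0 involve only exponents of smaller total degree, so the default 0 in `Φ` is
    -- never reached.
    refine ⟨(measure bideg).wf.fix Φ, fun k => ?_⟩
    rw [WellFounded.fix_eq]
    simp only [Φ]
    congr 1
    ext ξ
    congr 1
    refine Finset.sum_congr rfl fun x hx => ?_
    rw [Finset.mem_filter] at hx
    rw [dif_pos (hdec hx.1 hx.2)]
  have hHd : ∀ k, (∀ j, bideg j < bideg k → DifferentiableOn ℂ (u j) Ω) →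
      DifferentiableOn ℂ (fun ξ => g k -
        ∑ x ∈ Finset.HasAntidiagonal.antidiagonal k with x.1 ≠ 0, C x.1 (deriv (u x.2) ξ)) Ω := by
    intro k hk
    refine (differentiableOn_const _).sub (DifferentiableOn.fun_sum fun x hx => ?_)
    rw [Finset.mem_filter] at hx
    exact (C x.1).differentiable.comp_differentiableOn ((hk _ (hdec hx.1 hx.2)).deriv hO)
  have hdiff : ∀ n, ∀ k, bideg k = n → DifferentiableOn ℂ (u k) Ω := by
    intro n
    induction n using Nat.strong_induction_on with
    | _ n ih =>
      intro k hk
      rw [hu k]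
      exact (hS k _ (hHd k fun j hj => ih _ (hk ▸ hj) j rfl)).2.1
  have hmain := fun k => hS k _ (hHd k fun j _ => hdiff _ j rfl)
  simp only [← hu] at hmain
  set T : ℝ := ∑' j : Fin 2 →₀ ℕ, (1 / 2 : ℝ) ^ bideg j with hT
  have hTs : Summable fun j : Fin 2 →₀ ℕ => (1 / 2 : ℝ) ^ bideg j :=
    summable_pow_bideg (by norm_num) (by norm_num)
  have hT0 : 0 ≤ T := tsum_nonneg fun j => by positivity
  -- Chosen so that K A T ε ≤ 1/2. With q exp b = Q ε/2, each convolution term gains (ε/2)^|j| ≤ ε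
  -- 2^(-|j|) for j ≠ 0, and the bound 2KA Q^|k| reproduces itself: KA(1 + 2KATε) ≤ 2KA.
  let ε : ℝ := 1 / (2 * (K * A * T) + 1)
  have hε0 : 0 < ε := by positivity
  have hε1 : ε ≤ 1 := by
    rw [div_le_one (by positivity)]
    have : 0 ≤ K * A * T := by positivity
    linarith
  have hεK : K * A * T * ε ≤ 1 / 2 := by
    have : 0 ≤ K * A * T := by positivity
    simp only [ε]
    rw [mul_one_div, div_le_div_iff₀ (by positivity) (by norm_num)]
    linarith
  let Q : ℝ := q * Real.exp b * (2 / ε)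
  have hQ0 : 0 < Q := by positivity
  have hqQ : q * Real.exp b = Q * (ε / 2) := by simp only [Q]; field_simp
  have hqQ' : q * Real.exp b ≤ Q := by rw [hqQ]; nlinarith
  have hq' : q ≤ Q := by
    have : 1 ≤ Real.exp b := Real.one_le_exp hb
    nlinarith
  have hbound : ∀ n, ∀ k, bideg k = n → ∀ ξ ∈ Ω,
      ‖deriv (u k) ξ‖ ≤ 2 * K * A * Q ^ bideg k * borelWeight b (lam k) ξ := by
    intro n
    induction n using Nat.strong_induction_on with
    | _ n ih =>
      intro k hk
      have hsrc : ∀ ξ ∈ Ω, ‖g k - ∑ x ∈ Finset.HasAntidiagonal.antidiagonal k with x.1 ≠ 0,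
          C x.1 (deriv (u x.2) ξ)‖ ≤
          (A * Q ^ bideg k + A * (2 * K * A) * Q ^ bideg k * (ε * T)) *
            borelWeight b (lam k) ξ := by
        intro ξ hξ
        have hw := borelWeight_pos b (lam k) ξ
        rw [add_mul]
        refine (norm_sub_le _ _).trans (add_le_add ?_ ?_)
        · have h1 : 1 ≤ Real.exp b ^ bideg k * borelWeight b (lam k) ξ := by
            have := borelWeight_le (lam' := 0) hb (hlam k) ξ
            rw [add_zero] at this
            simpa [borelWeight] using this
          calc ‖g k‖ ≤ A * q ^ bideg k * 1 := by rw [mul_one]; exact hg k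
            _ ≤ A * q ^ bideg k * (Real.exp b ^ bideg k * borelWeight b (lam k) ξ) := by gcongr
            _ = A * (q * Real.exp b) ^ bideg k * borelWeight b (lam k) ξ := by
                rw [mul_pow]; ring
            _ ≤ _ := by gcongr
        · have hterm : ∀ x ∈ Finset.HasAntidiagonal.antidiagonal k, x.1 ≠ 0 →
              ‖C x.1 (deriv (u x.2) ξ)‖ ≤ A * (2 * K * A) * Q ^ bideg k *
                borelWeight b (lam k) ξ * ε * (1 / 2) ^ bideg x.1 := by
            intro x hx hx0
            have hsum := Finset.HasAntidiagonal.mem_antidiagonal.1 hx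
            have h1 := ih _ (hk ▸ hdec hx hx0) x.2 rfl ξ hξ
            have h2 := borelWeight_le (lam' := lam x.2) hb (hlam x.1) ξ
            rw [← hadd, hsum] at h2
            have hp : ε ^ bideg x.1 ≤ ε := pow_le_of_le_one hε0.le hε1 (bideg_pos hx0).ne'
            calc ‖C x.1 (deriv (u x.2) ξ)‖ ≤ ‖C x.1‖ * ‖deriv (u x.2) ξ‖ := (C x.1).le_opNorm _
              _ ≤ (A * q ^ bideg x.1) * (2 * K * A * Q ^ bideg x.2 *
                    (Real.exp b ^ bideg x.1 * borelWeight b (lam k) ξ)) := by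
                  gcongr
                  · exact hC _
                  · exact h1.trans (by gcongr)
              _ = A * (2 * K * A) * ((q * Real.exp b) ^ bideg x.1 * Q ^ bideg x.2) *
                    borelWeight b (lam k) ξ := by rw [mul_pow]; ring
              _ = A * (2 * K * A) * Q ^ bideg k * borelWeight b (lam k) ξ * ε ^ bideg x.1 *
                    (1 / 2) ^ bideg x.1 := by
                  rw [← hsum, bideg_add, hqQ, mul_pow, div_pow, pow_add, one_div, inv_pow]; ring
              _ ≤ _ := by gcongr
          calc _ ≤ ∑ x ∈ Finset.HasAntidiagonal.antidiagonal k with x.1 ≠ 0, A * (2 * K * A) * Q ^ bideg k *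
                borelWeight b (lam k) ξ * ε * (1 / 2) ^ bideg x.1 :=
                norm_sum_le_of_le _ fun x hx => by
                  rw [Finset.mem_filter] at hx
                  exact hterm x hx.1 hx.2
            _ ≤ ∑ x ∈ Finset.HasAntidiagonal.antidiagonal k, A * (2 * K * A) * Q ^ bideg k *
                borelWeight b (lam k) ξ * ε * (1 / 2) ^ bideg x.1 :=
                Finset.sum_le_sum_of_subset_of_nonneg (Finset.filter_subset _ _)
                  fun x _ _ => by positivity
            _ ≤ A * (2 * K * A) * Q ^ bideg k * borelWeight b (lam k) ξ * ε * T := by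
                rw [← Finset.mul_sum]
                gcongr
                exact sum_antidiagonal_fst_le_tsum hTs (fun j => by positivity) k
            _ = _ := by ring
      intro ξ hξ
      refine ((hmain k).2.2.2 _ hsrc ξ hξ).trans ?_
      have hw := borelWeight_pos b (lam k) ξ
      refine mul_le_mul_of_nonneg_right ?_ hw.le
      calc K * (A * Q ^ bideg k + A * (2 * K * A) * Q ^ bideg k * (ε * T))
          = K * A * Q ^ bideg k * (1 + 2 * (K * A * T * ε)) := by ring
        _ ≤ K * A * Q ^ bideg k * 2 := by gcongr; linarith
        _ = _ := by ring
  refine ⟨u, 2 * K * A, Q, by positivity, hQ0, hq', fun k => ⟨(hmain k).1, (hmain k).2.1,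
    fun ξ hξ => ?_, fun ξ hξ => (hbound _ k rfl ξ hξ).trans
      (mul_le_of_le_one_right (by positivity) (borelWeight_le_one hb (hlam0 k) ξ))⟩⟩
  rw [sum_antidiagonal_eq_add]
  have := (hmain k).2.2.1 ξ hξ
  simp only at this ⊢
  rw [add_sub_right_comm, this]
  abel

theorem hasDerivAt_iteratedDeriv_of_differentiableOn [CompleteSpace E] {Ω : Set ℂ} (hO : IsOpen Ω)
    {f : ℂ → E} (hf : DifferentiableOn ℂ f Ω) (n : ℕ) {ξ : ℂ} (hξ : ξ ∈ Ω) :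
    HasDerivAt (iteratedDeriv n f) (iteratedDeriv (n + 1) f ξ) ξ := by
  have : ∀ n, DifferentiableOn ℂ (iteratedDeriv n f) Ω := by
    intro n
    induction n with
    | zero => simpa using hf
    | succ n ih => rw [iteratedDeriv_succ]; exact ih.deriv hO
  rw [iteratedDeriv_succ]
  exact ((this n).differentiableAt (hO.mem_nhds hξ)).hasDerivAt

/-- The formal Borel transform of the solution, with the recursion for its Taylor coefficients. -/
theorem exists_borel_transform [CompleteSpace E] {Ω : Set ℂ} {δ b : ℝ} (hO : IsOpen Ω)
    (h0 : (0 : ℂ) ∈ Ω) (hb : 0 ≤ b)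
    (C : (Fin 2 →₀ ℕ) → E →L[ℂ] E) (L : List ℂ) (hL : ∀ μ ∈ L, IsBorelDomain Ω δ b μ)
    (hprod : (L.map fun μ => C 0 - μ • (1 : E →L[ℂ] E)).prod = 0)
    (lam : (Fin 2 →₀ ℕ) → ℝ) (hlam0 : ∀ k, 0 ≤ lam k) (hlam : ∀ k, lam k ≤ bideg k)
    (hadd : ∀ j k, lam (j + k) = lam j + lam k) (g : (Fin 2 →₀ ℕ) → E) {A q : ℝ} (hA : 0 ≤ A)
    (hq : 0 < q) (hC : ∀ k, ‖C k‖ ≤ A * q ^ bideg k) (hg : ∀ k, ‖g k‖ ≤ A * q ^ bideg k) :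
    ∃ (U : (Fin 2 →₀ ℕ) → ℂ → E) (M Q : ℝ), 0 ≤ M ∧ 0 < Q ∧
      (∀ k, DifferentiableOn ℂ (U k) Ω) ∧ (∀ k, ‖U k 0‖ ≤ M * Q ^ bideg k) ∧
      (∀ k, ∀ ξ ∈ Ω, ‖deriv (U k) ξ‖ ≤ M * Q ^ bideg k) ∧
      (∀ k, ∑ x ∈ Finset.HasAntidiagonal.antidiagonal k, C x.1 (U x.2 0) + g k = 0) ∧
      ∀ n k, ∑ x ∈ Finset.HasAntidiagonal.antidiagonal k, C x.1 (iteratedDeriv (n + 1) (U x.2) 0) =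
        ((n : ℂ) + lam k) • iteratedDeriv n (U k) 0 := by
  -- With `lam` = 0 and source -g, the equation at ξ = 0 reads C * u₀'(0) = -g as a convolution. So
  -- the derivatives at 0 are the coefficients F of -C⁻¹γ, together with a geometric bound.
  obtain ⟨u₀, M₀, Q₀, hM₀, hQ₀, hqQ₀, hu₀⟩ := exists_borel_family hO hb C L hL hprod (fun _ => 0)
    (fun _ => le_rfl) (fun _ => Nat.cast_nonneg _) (fun _ _ => (add_zero _).symm) (fun k => -g k)
    hA hq hC (by simpa using hg)
  let F : (Fin 2 →₀ ℕ) → E := fun k => deriv (u₀ k) 0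
  have hF : ∀ k, ‖F k‖ ≤ M₀ * Q₀ ^ bideg k := fun k => (hu₀ k).2.2.2 0 h0
  -- The source `lam k • F k` makes U = F + u a solution of the homogeneous equation with U(0) = F.
  -- The rate 2 Q₀ absorbs the factor lam k ≤ 2^|k|.
  obtain ⟨u, M, Q, hM, hQ, hqQ, hu⟩ := exists_borel_family hO hb C L hL hprod lam hlam0 hlam hadd
    (fun k => (lam k : ℂ) • F k) (A := A + M₀) (q := 2 * Q₀) (by positivity) (by positivity)
    (fun k => (hC k).trans (by
      gcongr
      · linarith
      · linarith))
    (fun k => by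
      have h2 : (bideg k : ℝ) ≤ 2 ^ bideg k := by exact_mod_cast (Nat.lt_two_pow_self).le
      rw [norm_smul, Complex.norm_real, Real.norm_of_nonneg (hlam0 k)]
      calc lam k * ‖F k‖ ≤ 2 ^ bideg k * (M₀ * Q₀ ^ bideg k) := by
            gcongr
            · exact (hlam k).trans h2
            · exact hF k
        _ = M₀ * (2 * Q₀) ^ bideg k := by rw [mul_pow]; ring
        _ ≤ _ := by gcongr; linarith)
  let U : (Fin 2 →₀ ℕ) → ℂ → E := fun k ξ => F k + u k ξ
  have hUd : ∀ k, DifferentiableOn ℂ (U k) Ω := fun k =>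
    (differentiableOn_const _).add (hu k).2.1
  have hderiv : ∀ k, deriv (U k) = deriv (u k) := fun k => by
    ext ξ; simp only [U]; rw [deriv_const_add]
  have hU0 : ∀ k, U k 0 = F k := fun k => by simp [U, (hu k).1]
  -- The equation differentiated n times; each derivative of ξ U' contributes one more to the factor
  -- n. At ξ = 0 this is the recursion for the Taylor coefficients.
  have hrec : ∀ n : ℕ, ∀ k, ∀ ξ ∈ Ω,
      ∑ x ∈ Finset.HasAntidiagonal.antidiagonal k, C x.1 (iteratedDeriv (n + 1) (U x.2) ξ) =
        ξ • iteratedDeriv (n + 1) (U k) ξ + ((n : ℂ) + lam k) • iteratedDeriv n (U k) ξ := by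
    intro n
    induction n with
    | zero =>
      intro k ξ hξ
      have := (hu k).2.2.1 ξ hξ
      rw [sub_eq_iff_eq_add'] at this
      simp only [zero_add, iteratedDeriv_one, iteratedDeriv_zero, hderiv]
      rw [this]
      simp only [U, smul_add, Nat.cast_zero, zero_add]
      abel
    | succ n ih =>
      intro k ξ hξ
      have h1 : HasDerivAt (fun ξ => ∑ x ∈ Finset.HasAntidiagonal.antidiagonal k,
          C x.1 (iteratedDeriv (n + 1) (U x.2) ξ))
          (∑ x ∈ Finset.HasAntidiagonal.antidiagonal k, C x.1 (iteratedDeriv (n + 1 + 1) (U x.2) ξ)) ξ :=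
        HasDerivAt.fun_sum fun x _ => (C x.1).hasFDerivAt.comp_hasDerivAt ξ
          (hasDerivAt_iteratedDeriv_of_differentiableOn hO (hUd x.2) (n + 1) hξ)
      have h2 := ((hasDerivAt_id ξ).fun_smul
        (hasDerivAt_iteratedDeriv_of_differentiableOn hO (hUd k) (n + 1) hξ)).fun_add
        ((hasDerivAt_iteratedDeriv_of_differentiableOn hO (hUd k) n hξ).fun_const_smul
          ((n : ℂ) + lam k))
      have h3 := h1.congr_of_eventuallyEq (f₁ := fun ξ => ξ • iteratedDeriv (n + 1) (U k) ξ +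
        ((n : ℂ) + lam k) • iteratedDeriv n (U k) ξ) (by
          filter_upwards [hO.mem_nhds hξ] with z hz using (ih k z hz).symm)
      rw [h3.unique h2]
      push_cast
      simp only [id]
      module
  refine ⟨U, M + M₀, Q + Q₀, by positivity, by positivity, hUd, fun k => ?_, fun k ξ hξ => ?_,
    fun k => ?_, fun n k => ?_⟩
  · rw [hU0]
    refine (hF k).trans ?_
    gcongr
    · linarith
    · linarith
  · rw [hderiv]
    refine ((hu k).2.2.2 ξ hξ).trans ?_
    gcongr
    · linarith
    · linarith
  · have := (hu₀ k).2.2.1 0 h0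
    simp only [zero_smul, sub_zero, Complex.ofReal_zero, zero_add] at this
    simp only [hU0]
    rw [this, neg_add_cancel]
  · simpa using hrec n k 0 h0

end MonomialSummability

/-! ### Laplace transforms and Borel summation -/

namespace MonomialSummability

open Set Metric Filter Topology MeasureTheory

variable {E : Type*} [NormedAddCommGroup E] [NormedSpace ℂ E]

theorem integrableOn_pow_mul_exp_neg (n : ℕ) {a : ℝ} (ha : 0 < a) :
    IntegrableOn (fun r : ℝ => r ^ n * Real.exp (-(a * r))) (Ioi 0) := by
  have := integrableOn_rpow_mul_exp_neg_mul_rpow (p := 1) (s := n) (b := a)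
    (by linarith [n.cast_nonneg (α := ℝ)]) one_pos ha
  simpa [Real.rpow_natCast] using this

theorem integral_pow_mul_exp_neg (n : ℕ) {a : ℝ} (ha : 0 < a) :
    ∫ r in Ioi (0 : ℝ), r ^ n * Real.exp (-(a * r)) = n.factorial / a ^ (n + 1) := by
  have := Real.integral_rpow_mul_exp_neg_mul_Ioi (a := n + 1) (r := a) (by positivity) ha
  rw [Real.Gamma_nat_eq_factorial, add_sub_cancel_right] at this
  simp only [Real.rpow_natCast] at this
  rw [this, ← Nat.cast_succ, Real.rpow_natCast, one_div, inv_pow, inv_mul_eq_div]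

theorem norm_cexp_neg_mul_ofReal (z : ℂ) (r : ℝ) :
    ‖Complex.exp (-(z * r))‖ = Real.exp (-(z.re * r)) := by
  rw [Complex.norm_exp, Complex.neg_re, Complex.re_mul_ofReal]

theorem integrableOn_pow_mul_cexp_neg (n : ℕ) {z : ℂ} (hz : 0 < z.re) :
    IntegrableOn (fun r : ℝ => (r : ℂ) ^ n * Complex.exp (-(z * r))) (Ioi 0) := by
  refine Integrable.mono' (integrableOn_pow_mul_exp_neg n hz)
    (Continuous.aestronglyMeasurable (by fun_prop)) ?_
  filter_upwards [ae_restrict_mem measurableSet_Ioi] with r hr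
  have hr' : 0 < r := hr
  rw [norm_mul, norm_pow, Complex.norm_real, Real.norm_of_nonneg hr'.le, norm_cexp_neg_mul_ofReal]

theorem tendsto_pow_mul_cexp_neg (n : ℕ) {z : ℂ} (hz : 0 < z.re) :
    Tendsto (fun r : ℝ => (r : ℂ) ^ n * Complex.exp (-(z * r))) atTop (𝓝 0) := by
  have := tendsto_rpow_mul_exp_neg_mul_atTop_nhds_zero n z.re hz
  refine squeeze_zero_norm' ?_ this
  filter_upwards [eventually_ge_atTop 0] with r hr
  rw [norm_mul, norm_pow, Complex.norm_real, Real.norm_of_nonneg hr, norm_cexp_neg_mul_ofReal,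
    Real.rpow_natCast, neg_mul]

theorem hasDerivAt_cexp_neg_mul_ofReal (z : ℂ) (r : ℝ) :
    HasDerivAt (fun r : ℝ => Complex.exp (-(z * r))) (Complex.exp (-(z * r)) * -z) r := by
  have h1 : HasDerivAt (fun r : ℝ => -(z * (r : ℂ))) (-z) r := by
    simpa using ((Complex.ofRealCLM.hasDerivAt (x := r)).const_mul z).fun_neg
  exact h1.cexp

theorem integral_pow_mul_cexp_neg (n : ℕ) {z : ℂ} (hz : 0 < z.re) :
    ∫ r in Ioi (0 : ℝ), (r : ℂ) ^ n * Complex.exp (-(z * r)) = n.factorial / z ^ (n + 1) := by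
  have hz0 : z ≠ 0 := by rintro rfl; simp at hz
  induction n with
  | zero =>
    have h := integral_Ioi_of_hasDerivAt_of_tendsto' (a := (0 : ℝ))
      (fun r _ => (hasDerivAt_cexp_neg_mul_ofReal z r).mul_const (-z⁻¹))
      (f' := fun r : ℝ => Complex.exp (-(z * r)) * -z * -z⁻¹) (m := 0)
      (((integrableOn_pow_mul_cexp_neg 0 hz).congr_fun (fun r _ => by
        field_simp) measurableSet_Ioi))
      (by simpa using (tendsto_pow_mul_cexp_neg 0 hz).mul_const (-z⁻¹))
    simp only [neg_mul_neg, mul_assoc, mul_inv_cancel₀ hz0, mul_one] at h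
    simp [h]
  | succ n ih =>
    have h0 := (integrableOn_pow_mul_cexp_neg (n + 1) hz)
    have h1 := (integrableOn_pow_mul_cexp_neg n hz).const_mul (((n + 1 : ℕ) : ℂ) / z)
    have hd : ∀ r : ℝ, HasDerivAt
        (fun r : ℝ => (r : ℂ) ^ (n + 1) * Complex.exp (-(z * r)) * -z⁻¹)
        ((r : ℂ) ^ (n + 1) * Complex.exp (-(z * r)) -
          ((n + 1 : ℕ) : ℂ) / z * ((r : ℂ) ^ n * Complex.exp (-(z * r)))) r := by
      intro r
      have h2 : HasDerivAt (fun r : ℝ => (r : ℂ) ^ (n + 1)) (((n + 1 : ℕ) : ℂ) * (r : ℂ) ^ n) r := by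
        simpa using (Complex.ofRealCLM.hasDerivAt (x := r)).fun_pow (n + 1)
      refine ((h2.fun_mul (hasDerivAt_cexp_neg_mul_ofReal z r)).mul_const (-z⁻¹)).congr_deriv ?_
      field_simp
      ring
    have h := integral_Ioi_of_hasDerivAt_of_tendsto' (a := (0 : ℝ)) (fun r _ => hd r) (m := 0)
      (h0.sub h1) (by simpa using (tendsto_pow_mul_cexp_neg (n + 1) hz).mul_const (-z⁻¹))
    rw [integral_sub h0 h1, integral_const_mul, ih] at h
    simp only [Complex.ofReal_zero, ne_eq, Nat.add_eq_zero_iff, one_ne_zero, and_false,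
      not_false_eq_true, zero_pow, zero_mul, sub_zero] at h
    rw [sub_eq_zero.1 h, Nat.factorial_succ, pow_succ z (n + 1)]
    push_cast
    field_simp

/-- The Laplace transform of `B` along the ray through `v`. -/
noncomputable def laplace (B : ℂ → E) (v t : ℂ) : E :=
  ∫ r in Ioi (0 : ℝ), (v * Complex.exp (-(v / t * r))) • B (r * v)

theorem continuousOn_ray {F : Type*} [TopologicalSpace F] {B : ℂ → F} {Ω : Set ℂ} (hB : ContinuousOn B Ω) {v : ℂ}
    (hv : ∀ r : ℝ, 0 ≤ r → r * v ∈ Ω) : ContinuousOn (fun r : ℝ => B (r * v)) (Ici 0) :=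
  hB.comp (by fun_prop) fun r hr => hv r hr

theorem aestronglyMeasurable_ray {B : ℂ → E} {Ω : Set ℂ} (hB : ContinuousOn B Ω) {v : ℂ}
    (hv : ∀ r : ℝ, 0 ≤ r → r * v ∈ Ω) {h : ℝ → ℂ} (hh : Continuous h) :
    AEStronglyMeasurable (fun r : ℝ => h r • B (r * v)) (volume.restrict (Ioi 0)) :=
  ((hh.continuousOn.smul (continuousOn_ray hB hv)).mono
    Ioi_subset_Ici_self).aestronglyMeasurable measurableSet_Ioi

theorem integrableOn_laplace {B : ℂ → E} {Ω : Set ℂ} (hB : ContinuousOn B Ω) {M : ℝ}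
    (hM : ∀ ξ ∈ Ω, ‖B ξ‖ ≤ M) {v : ℂ} (hv : ∀ r : ℝ, 0 ≤ r → r * v ∈ Ω) {z : ℂ} (hz : 0 < z.re) :
    IntegrableOn (fun r : ℝ => (v * Complex.exp (-(z * r))) • B (r * v)) (Ioi 0) := by
  refine Integrable.mono' (((integrableOn_pow_mul_exp_neg 0 hz).const_mul (‖v‖ * M)))
    (aestronglyMeasurable_ray hB hv (by fun_prop)) ?_
  filter_upwards [ae_restrict_mem measurableSet_Ioi] with r hr
  rw [norm_smul, norm_mul, norm_cexp_neg_mul_ofReal, pow_zero, one_mul]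
  calc _ ≤ ‖v‖ * Real.exp (-(z.re * r)) * M := by gcongr; exact hM _ (hv r hr.le)
    _ = _ := by ring

theorem differentiableAt_laplace [CompleteSpace E] {B : ℂ → E} {Ω : Set ℂ}
    (hB : ContinuousOn B Ω) {M : ℝ} (hM : ∀ ξ ∈ Ω, ‖B ξ‖ ≤ M) {v : ℂ}
    (hv : ∀ r : ℝ, 0 ≤ r → r * v ∈ Ω) {t : ℂ} (ht : t ≠ 0) (hre : 0 < (v / t).re) :
    DifferentiableAt ℂ (laplace B v) t := by
  -- In the variable z = v/t the integrand depends on z only through exp(-zr), so differentiation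
  -- under the integral applies, dominated on the half plane Re z > Re z₀ / 2.
  have key : ∀ z₀ : ℂ, 0 < z₀.re → DifferentiableAt ℂ
      (fun z : ℂ => ∫ r in Ioi (0 : ℝ), (v * Complex.exp (-(z * r))) • B (r * v)) z₀ := by
    intro z₀ hz₀
    have hopen : {z : ℂ | z₀.re / 2 < z.re} ∈ 𝓝 z₀ :=
      (isOpen_lt continuous_const Complex.continuous_re).mem_nhds (by simp; linarith)
    refine (hasDerivAt_integral_of_dominated_loc_of_deriv_le (𝕜 := ℂ) hopen
      (F := fun z (r : ℝ) => (v * Complex.exp (-(z * r))) • B (r * v))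
      (F' := fun z (r : ℝ) => (v * (Complex.exp (-(z * r)) * -(r : ℂ))) • B (r * v))
      (bound := fun r => ‖v‖ * M * (r ^ 1 * Real.exp (-(z₀.re / 2 * r))))
      (.of_forall fun z => aestronglyMeasurable_ray hB hv (by fun_prop))
      (integrableOn_laplace hB hM hv hz₀) (aestronglyMeasurable_ray hB hv (by fun_prop)) ?_
      ((integrableOn_pow_mul_exp_neg 1 (by positivity)).const_mul (‖v‖ * M)) ?_).2.differentiableAt
    · filter_upwards [ae_restrict_mem measurableSet_Ioi] with r hr z hz
      have hr' : 0 < r := hr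
      have hz' : z₀.re / 2 < z.re := hz
      rw [norm_smul, norm_mul, norm_mul, norm_cexp_neg_mul_ofReal, norm_neg, Complex.norm_real,
        Real.norm_of_nonneg hr'.le]
      have hM0 : 0 ≤ M := (norm_nonneg _).trans (hM _ (hv r hr'.le))
      calc _ ≤ ‖v‖ * (Real.exp (-(z₀.re / 2 * r)) * r) * M := by
            gcongr
            exact hM _ (hv r hr'.le)
        _ = _ := by ring
    · filter_upwards with r z _
      have h1 : HasDerivAt (fun z : ℂ => -(z * r)) (-(r : ℂ)) z := by
        simpa using ((hasDerivAt_id z).mul_const (r : ℂ)).fun_neg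
      exact (h1.cexp.const_mul v).smul_const (B (r * v))
  exact (key (v / t) hre).comp t (f := fun t => v / t)
    (DifferentiableAt.div (by fun_prop) (by fun_prop) ht)

theorem laplace_pow {v t : ℂ} (hre : 0 < (v / t).re) (n : ℕ) (y : E) [CompleteSpace E] :
    laplace (fun ξ => (ξ ^ n / (n.factorial : ℂ)) • y) v t = t ^ (n + 1) • y := by
  have hv : v ≠ 0 := by rintro rfl; simp at hre
  have hn : (n.factorial : ℂ) ≠ 0 := by exact_mod_cast n.factorial_ne_zero
  have h1 : ∀ r : ℝ, (v * Complex.exp (-(v / t * r))) • ((r * v) ^ n / (n.factorial : ℂ)) • y =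
      ((r : ℂ) ^ n * Complex.exp (-(v / t * r))) • (v ^ (n + 1) / (n.factorial : ℂ)) • y := by
    intro r
    rw [smul_smul, smul_smul]
    congr 1
    ring
  simp only [laplace, h1]
  rw [integral_smul_const, integral_pow_mul_cexp_neg n hre, smul_smul, div_pow]
  congr 1
  field_simp

/-- Gevrey estimate for the Laplace transform along one ray. -/
theorem norm_laplace_sub_le [CompleteSpace E] {B : ℂ → E} {Ω : Set ℂ} {ρ M : ℝ} (hρ : 0 < ρ)
    (hball : closedBall 0 ρ ⊆ Ω)
    (hB : DifferentiableOn ℂ B Ω) (hM : ∀ ξ ∈ Ω, ‖B ξ‖ ≤ M) {v : ℂ} (hv1 : ‖v‖ = 1)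
    (hv : ∀ r : ℝ, 0 ≤ r → r * v ∈ Ω) {t : ℂ} (hre : 0 < (v / t).re) (N : ℕ) :
    ‖laplace B v t - ∑ n ∈ Finset.range N, t ^ (n + 1) • iteratedDeriv n B 0‖ ≤
      3 * M * (2 / ρ) ^ N * (N.factorial / (v / t).re ^ (N + 1)) := by
  have hM0 : 0 ≤ M := (norm_nonneg _).trans (hM 0 (hball (mem_closedBall_self hρ.le)))
  let P : ℂ → E := fun ξ => ∑ n ∈ Finset.range N, (ξ ^ n / (n.factorial : ℂ)) • iteratedDeriv n B 0
  -- Cauchy's remainder handles |ξ| ≤ ρ/2. Farther out 2|ξ|/ρ ≥ 1, so B and every Taylor term are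
  -- bounded separately; the factors (1/2)^n make the sum independent of N up to a constant.
  have hrem : ∀ ξ ∈ Ω, ‖B ξ - P ξ‖ ≤ 3 * M * (2 / ρ) ^ N * ‖ξ‖ ^ N := by
    intro ξ hξ
    rcases le_or_gt ‖ξ‖ (ρ / 2) with h | h
    · calc ‖B ξ - P ξ‖ ≤ 2 * M * (‖ξ‖ / ρ) ^ N :=
            norm_sub_taylor_le hρ (hB.mono hball) (fun z hz => hM z (hball hz)) N h
        _ = 2 * M * (1 / ρ) ^ N * ‖ξ‖ ^ N := by rw [div_pow, div_pow]; ring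
        _ ≤ _ := by gcongr <;> norm_num
    · have hx : 1 ≤ 2 / ρ * ‖ξ‖ := by rw [div_mul_eq_mul_div, le_div_iff₀ hρ]; linarith
      have hterm : ∀ n ∈ Finset.range N, ‖(ξ ^ n / (n.factorial : ℂ)) • iteratedDeriv n B 0‖ ≤
          M * (2 / ρ * ‖ξ‖) ^ N * (1 / 2) ^ n := by
        intro n hn
        have h := Complex.norm_iteratedDeriv_le_of_forall_mem_sphere_norm_le n hρ
          (hB.diffContOnCl_ball hball) (fun z hz => hM z (hball (sphere_subset_closedBall hz)))
        have hf : (0 : ℝ) < n.factorial := by exact_mod_cast n.factorial_pos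
        rw [norm_smul, norm_div, norm_pow, Complex.norm_natCast]
        calc ‖ξ‖ ^ n / n.factorial * ‖iteratedDeriv n B 0‖
            ≤ ‖ξ‖ ^ n / n.factorial * (n.factorial * M / ρ ^ n) := by gcongr
          _ = M * (2 / ρ * ‖ξ‖) ^ n * (1 / 2) ^ n := by
              rw [mul_pow, div_pow, div_pow]; field_simp; simp
          _ ≤ _ := by
              gcongr
              exact (Finset.mem_range.1 hn).le
      have hgeo : ∑ n ∈ Finset.range N, (1 / 2 : ℝ) ^ n ≤ 2 := by
        refine (summable_geometric_two.sum_le_tsum _ fun i _ => by positivity).trans ?_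
        rw [tsum_geometric_two]
      calc ‖B ξ - P ξ‖ ≤ ‖B ξ‖ + ‖P ξ‖ := norm_sub_le _ _
        _ ≤ M * (2 / ρ * ‖ξ‖) ^ N + M * (2 / ρ * ‖ξ‖) ^ N * 2 := by
            refine add_le_add ((hM ξ hξ).trans
              (le_mul_of_one_le_right hM0 (one_le_pow₀ hx))) ?_
            refine (norm_sum_le_of_le _ hterm).trans ?_
            rw [← Finset.mul_sum]
            gcongr
        _ = _ := by rw [mul_pow]; ring
  have hPc : Continuous P := by fun_prop
  have hintegr : ∀ n, IntegrableOn (fun r : ℝ => (v * Complex.exp (-(v / t * r))) •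
      (((r * v : ℂ) ^ n / (n.factorial : ℂ)) • iteratedDeriv n B 0)) (Ioi 0) := by
    intro n
    refine Integrable.mono' ((integrableOn_pow_mul_exp_neg n hre).const_mul
      (1 / n.factorial * ‖iteratedDeriv n B 0‖)) (Continuous.aestronglyMeasurable (by fun_prop)) ?_
    filter_upwards [ae_restrict_mem measurableSet_Ioi] with r hr
    have hr' : 0 < r := hr
    rw [norm_smul, norm_smul, norm_mul, norm_cexp_neg_mul_ofReal, norm_div, norm_pow, norm_mul, hv1,
      Complex.norm_real, Real.norm_of_nonneg hr'.le, Complex.norm_natCast]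
    exact le_of_eq (by ring)
  have hlap : laplace B v t - ∑ n ∈ Finset.range N, t ^ (n + 1) • iteratedDeriv n B 0 =
      ∫ r in Ioi (0 : ℝ), (v * Complex.exp (-(v / t * r))) • (B (r * v) - P (r * v)) := by
    simp only [smul_sub]
    rw [integral_sub (integrableOn_laplace hB.continuousOn hM hv hre)]
    · congr 1
      simp only [P, Finset.smul_sum]
      rw [integral_finsetSum _ fun n _ => hintegr n]
      exact Finset.sum_congr rfl fun n _ => (laplace_pow hre n _).symm
    · simp only [P, Finset.smul_sum]
      exact integrable_finsetSum _ fun n _ => hintegr n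
  rw [hlap]
  refine (norm_integral_le_of_norm_le ((integrableOn_pow_mul_exp_neg N hre).const_mul
    (3 * M * (2 / ρ) ^ N)) ?_).trans ?_
  · filter_upwards [ae_restrict_mem measurableSet_Ioi] with r hr
    have hr' : 0 < r := hr
    rw [norm_smul, norm_mul, norm_cexp_neg_mul_ofReal, hv1, one_mul]
    have := hrem _ (hv r hr'.le)
    rw [norm_mul, hv1, Complex.norm_real, Real.norm_of_nonneg hr'.le, mul_one] at this
    calc _ ≤ Real.exp (-((v / t).re * r)) * (3 * M * (2 / ρ) ^ N * r ^ N) := by gcongr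
      _ = _ := by ring
  · rw [integral_const_mul, integral_pow_mul_exp_neg N hre]

/-- Laplace transforms along two rays of a convex domain agree where both are defined. -/
theorem laplace_eq_laplace [CompleteSpace E] {B : ℂ → E} {Ω : Set ℂ} (hO : IsOpen Ω)
    (hconv : Convex ℝ Ω)
    (hB : DifferentiableOn ℂ B Ω) {M : ℝ} (hM : ∀ ξ ∈ Ω, ‖B ξ‖ ≤ M) {v₁ v₂ : ℂ}
    (hv₁ : ∀ r : ℝ, 0 ≤ r → r * v₁ ∈ Ω) (hv₂ : ∀ r : ℝ, 0 ≤ r → r * v₂ ∈ Ω) {t : ℂ}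
    (h₁ : 0 < (v₁ / t).re) (h₂ : 0 < (v₂ / t).re) : laplace B v₁ t = laplace B v₂ t := by
  have hM0 : 0 ≤ M := (norm_nonneg _).trans (hM _ (hv₁ 0 le_rfl))
  have hgd : DifferentiableOn ℂ (fun ξ => Complex.exp (-(ξ / t)) • B ξ) Ω :=
    DifferentiableOn.smul (by fun_prop) hB
  obtain ⟨G, hG⟩ := hconv.exists_forall_hasDerivWithinAt hgd
  have hlim : ∀ v : ℂ, (∀ r : ℝ, 0 ≤ r → r * v ∈ Ω) → 0 < (v / t).re →
      Tendsto (fun R : ℝ => G (R * v) - G 0) atTop (𝓝 (laplace B v t)) := by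
    intro v hv hre
    have hintegr := integrableOn_laplace hB.continuousOn hM hv hre
    refine (intervalIntegral_tendsto_integral_Ioi 0 hintegr tendsto_id).congr' ?_
    filter_upwards [eventually_ge_atTop 0] with R hR
    have hd : ∀ r ∈ uIcc 0 R, HasDerivAt (fun r : ℝ => G (r * v))
        ((v * Complex.exp (-(v / t * r))) • B (r * v)) r := by
      intro r hr
      rw [uIcc_of_le hR] at hr
      have h1 : HasDerivAt (fun r : ℝ => (r : ℂ) * v) v r := by
        simpa using (Complex.ofRealCLM.hasDerivAt (x := r)).mul_const v
      have h2 := ((hG _ (hv r hr.1)).hasDerivAt (hO.mem_nhds (hv r hr.1))).scomp r h1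
      refine h2.congr_deriv ?_
      rw [smul_smul]
      congr 3
      ring
    have := intervalIntegral.integral_eq_sub_of_hasDerivAt hd
      ((intervalIntegrable_iff_integrableOn_Ioc_of_le hR).2 (hintegr.mono_set Ioc_subset_Ioi_self))
    simpa using this
  have hdiff : Tendsto (fun R : ℝ => (G (R * v₁) - G 0) - (G (R * v₂) - G 0)) atTop (𝓝 0) := by
    set a := min (v₁ / t).re (v₂ / t).re with ha
    have ha0 : 0 < a := lt_min h₁ h₂
    have hz : Tendsto (fun R : ℝ => M * ‖v₁ - v₂‖ * (R ^ (1 : ℝ) * Real.exp (-a * R))) atTop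
        (𝓝 0) := by
      simpa using (tendsto_rpow_mul_exp_neg_mul_atTop_nhds_zero 1 a ha0).const_mul
        (M * ‖v₁ - v₂‖)
    refine squeeze_zero_norm' ?_ hz
    filter_upwards [eventually_ge_atTop 0] with R hR
    -- The two truncated integrals differ by the integral over the chord joining the endpoints. The
    -- chord has length R|v₁ - v₂| and lies in Re(ξ/t) ≥ R a, where the exponential beats this
    -- length.
    have hseg : segment ℝ ((R : ℂ) * v₂) (R * v₁) ⊆ Ω :=
      hconv.segment_subset (hv₂ R hR) (hv₁ R hR)
    have hhalf : segment ℝ ((R : ℂ) * v₂) (R * v₁) ⊆ {ξ : ℂ | R * a ≤ (ξ / t).re} := by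
      have hc : Convex ℝ {ξ : ℂ | R * a ≤ (ξ / t).re} := by
        intro x hx y hy α β hα hβ hαβ
        simp only [mem_ofPred_eq] at hx hy ⊢
        have : ((α • x + β • y) / t).re = α * (x / t).re + β * (y / t).re := by
          rw [add_div, Complex.add_re, Complex.real_smul, Complex.real_smul, mul_div_assoc,
            mul_div_assoc, Complex.re_ofReal_mul, Complex.re_ofReal_mul]
        rw [this]
        calc R * a = α * (R * a) + β * (R * a) := by rw [← add_mul, hαβ, one_mul]
          _ ≤ _ := by gcongr
      refine hc.segment_subset ?_ ?_
      · simp only [mem_ofPred_eq]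
        rw [mul_div_assoc, Complex.re_ofReal_mul]
        gcongr
        exact min_le_right _ _
      · simp only [mem_ofPred_eq]
        rw [mul_div_assoc, Complex.re_ofReal_mul]
        gcongr
        exact min_le_left _ _
    have := (convex_segment (𝕜 := ℝ) ((R : ℂ) * v₂) (R * v₁)).norm_image_sub_le_of_norm_hasDerivWithin_le
      (f := G) (C := Real.exp (-(R * a)) * M)
      (fun ξ hξ => ((hG ξ (hseg hξ)).mono hseg)) (fun ξ hξ => by
        rw [norm_smul, Complex.norm_exp]
        gcongr
        · rw [Complex.neg_re]; exact neg_le_neg (hhalf hξ)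
        · exact hM _ (hseg hξ)) (left_mem_segment ℝ _ _) (right_mem_segment ℝ _ _)
    rw [sub_sub_sub_cancel_right]
    refine this.trans (le_of_eq ?_)
    rw [← mul_sub, norm_mul, Complex.norm_real, Real.norm_of_nonneg hR, Real.rpow_one]
    ring_nf
  have := (hlim v₁ hv₁ h₁).sub (hlim v₂ hv₂ h₂)
  exact sub_eq_zero.1 (tendsto_nhds_unique this hdiff)

/-- Two adjacent half planes in the `1 / t` plane, cut down by `ε`. -/
def twoRaySector (v₁ v₂ : ℂ) (ε : ℝ) : Set ℂ :=
  {t | t ≠ 0 ∧ (ε < ‖t‖ * (v₁ / t).re ∨ ε < ‖t‖ * (v₂ / t).re)}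

theorem isOpen_twoRaySector (v₁ v₂ : ℂ) (ε : ℝ) : IsOpen (twoRaySector v₁ v₂ ε) := by
  have hc : ∀ v : ℂ, ContinuousOn (fun t : ℂ => ‖t‖ * (v / t).re) {t | t ≠ 0} := fun v =>
    continuous_norm.continuousOn.mul (Complex.continuous_re.comp_continuousOn
      (ContinuousOn.div (by fun_prop) (by fun_prop) fun t ht => ht))
  have ho : ∀ v : ℂ, IsOpen ({t : ℂ | t ≠ 0} ∩ (fun t : ℂ => ‖t‖ * (v / t).re) ⁻¹' Ioi ε) :=
    fun v => (hc v).isOpen_inter_preimage isOpen_ne isOpen_Ioi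
  convert (ho v₁).union (ho v₂) using 1
  ext t
  simp only [twoRaySector, mem_ofPred_eq, mem_union, mem_inter_iff, mem_preimage, mem_Ioi]
  tauto

/-- Borel summation: from the Borel transform `U` to a holomorphic function on a sector of opening
larger than `π` with a Gevrey estimate. -/
theorem exists_borel_sum [CompleteSpace E] {U : ℂ → E} {Ω : Set ℂ} {ρ ε M : ℝ} (hO : IsOpen Ω)
    (hconv : Convex ℝ Ω) (hρ : 0 < ρ) (hball : closedBall 0 ρ ⊆ Ω) (hU : DifferentiableOn ℂ U Ω)
    (hU0 : ‖U 0‖ ≤ M) (hM : ∀ ξ ∈ Ω, ‖deriv U ξ‖ ≤ M) {v₁ v₂ : ℂ} (hn₁ : ‖v₁‖ = 1)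
    (hn₂ : ‖v₂‖ = 1) (hv₁ : ∀ r : ℝ, 0 ≤ r → r * v₁ ∈ Ω) (hv₂ : ∀ r : ℝ, 0 ≤ r → r * v₂ ∈ Ω)
    (hε : 0 < ε) (hε1 : ε ≤ 1) :
    ∃ W : ℂ → E, DifferentiableOn ℂ W (twoRaySector v₁ v₂ ε) ∧
      ∀ t ∈ twoRaySector v₁ v₂ ε, ‖t‖ ≤ 1 → ∀ N : ℕ,
        ‖W t - ∑ n ∈ Finset.range N, t ^ n • iteratedDeriv n U 0‖ ≤
          4 * M / ε * ((1 + 2 / ρ) / ε) ^ N * N.factorial * ‖t‖ ^ N := by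
  have hBd : DifferentiableOn ℂ (deriv U) Ω := hU.deriv hO
  have hM0 : 0 ≤ M := (norm_nonneg _).trans hU0
  -- The two half-plane transforms glue to one function because they agree on the overlap.
  let Y : ℂ → E := fun t => if 0 < (v₁ / t).re then laplace (deriv U) v₁ t
    else laplace (deriv U) v₂ t
  have hY₁ : ∀ t, 0 < (v₁ / t).re → Y t = laplace (deriv U) v₁ t := fun t ht => if_pos ht
  have hY₂ : ∀ t, 0 < (v₂ / t).re → Y t = laplace (deriv U) v₂ t := by
    intro t ht
    by_cases h : 0 < (v₁ / t).re
    · rw [hY₁ t h, laplace_eq_laplace hO hconv hBd hM hv₁ hv₂ h ht]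
    · exact if_neg h
  have hpos : ∀ v t : ℂ, t ≠ 0 → ε < ‖t‖ * (v / t).re → 0 < (v / t).re := by
    intro v t ht h
    have := norm_pos_iff.2 ht
    exact pos_of_mul_pos_right (hε.trans h) this.le
  have hnhds : ∀ v t : ℂ, t ≠ 0 → 0 < (v / t).re → ∀ᶠ t' in 𝓝 t, 0 < (v / t').re := by
    intro v t ht h
    have : ContinuousAt (fun t : ℂ => (v / t).re) t :=
      Complex.continuous_re.continuousAt.comp (ContinuousAt.div (by fun_prop) (by fun_prop) ht)
    exact this.eventually (lt_mem_nhds h)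
  have hest : ∀ v : ℂ, ‖v‖ = 1 → (∀ r : ℝ, 0 ≤ r → r * v ∈ Ω) → ∀ t : ℂ, t ≠ 0 → ‖t‖ ≤ 1 →
      ε < ‖t‖ * (v / t).re → ∀ N : ℕ,
      ‖U 0 + laplace (deriv U) v t - ∑ n ∈ Finset.range N, t ^ n • iteratedDeriv n U 0‖ ≤
          4 * M / ε * ((1 + 2 / ρ) / ε) ^ N * N.factorial * ‖t‖ ^ N := by
    intro v hnv hv t ht ht1 hεt N
    have hre := hpos v t ht hεt
    have htn := norm_pos_iff.2 ht
    have hinv : 1 / (v / t).re ≤ ‖t‖ / ε := by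
      rw [div_le_div_iff₀ hre hε]; linarith
    -- For N = n + 1 the constant term U(0) cancels, and the remainder of order n for the Laplace
    -- transform of U' already carries the power n + 1. For N = 0 both summands are bounded
    -- directly.
    rcases N with _ | n
    · have h0 := norm_laplace_sub_le hρ hball hBd hM hnv hv hre 0
      simp only [Finset.range_zero, Finset.sum_empty, sub_zero, pow_zero, mul_one,
        Nat.factorial_zero, Nat.cast_one, zero_add, pow_one] at h0 ⊢
      have h1 : 1 / (v / t).re ≤ 1 / ε := hinv.trans (by gcongr)
      have h2 : (1 : ℝ) ≤ 1 / ε := by rw [le_div_iff₀ hε]; linarith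
      calc ‖U 0 + laplace (deriv U) v t‖ ≤ M * 1 + 3 * M * (1 / (v / t).re) := by
            rw [mul_one]; exact (norm_add_le _ _).trans (add_le_add hU0 h0)
        _ ≤ M * (1 / ε) + 3 * M * (1 / ε) := by gcongr
        _ = _ := by ring
    · rw [Finset.sum_range_succ']
      simp only [pow_zero, one_smul, iteratedDeriv_zero, iteratedDeriv_succ']
      have h0 := norm_laplace_sub_le hρ hball hBd hM hnv hv hre n
      rw [add_comm (U 0), add_sub_add_right_eq_sub]
      refine h0.trans ?_
      have hfac : (n.factorial : ℝ) ≤ (n + 1).factorial := by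
        exact_mod_cast Nat.factorial_le n.le_succ
      have hc1 : (2 / ρ) ^ n ≤ (1 + 2 / ρ) ^ (n + 1) := by
        have h2 : (0 : ℝ) ≤ 2 / ρ := by positivity
        calc (2 / ρ) ^ n ≤ (1 + 2 / ρ) ^ n := by gcongr; linarith
          _ ≤ (1 + 2 / ρ) ^ (n + 1) := pow_le_pow_right₀ (by linarith) n.le_succ
      calc 3 * M * (2 / ρ) ^ n * (n.factorial / (v / t).re ^ (n + 1))
          = 3 * M * (2 / ρ) ^ n * n.factorial * (1 / (v / t).re) ^ (n + 1) := by
            rw [one_div, inv_pow]; ring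
        _ ≤ 3 * M * (1 + 2 / ρ) ^ (n + 1) * (n + 1).factorial * (‖t‖ / ε) ^ (n + 1) := by
            gcongr
        _ = 3 * M * (((1 + 2 / ρ) / ε) ^ (n + 1) * (n + 1).factorial * ‖t‖ ^ (n + 1)) := by
            rw [div_pow, div_pow]; ring
        _ ≤ 4 * M / ε * (((1 + 2 / ρ) / ε) ^ (n + 1) * (n + 1).factorial * ‖t‖ ^ (n + 1)) := by
            gcongr
            rw [le_div_iff₀ hε]
            nlinarith
        _ = _ := by ring
  refine ⟨fun t => U 0 + Y t, fun t ht => ?_, fun t ht ht1 N => ?_⟩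
  · refine (DifferentiableAt.const_add _ ?_).differentiableWithinAt
    obtain ⟨ht0, h | h⟩ := ht
    · have hre := hpos v₁ t ht0 h
      refine (differentiableAt_laplace hBd.continuousOn hM hv₁ ht0 hre).congr_of_eventuallyEq ?_
      filter_upwards [hnhds v₁ t ht0 hre] with t' ht' using hY₁ t' ht'
    · have hre := hpos v₂ t ht0 h
      refine (differentiableAt_laplace hBd.continuousOn hM hv₂ ht0 hre).congr_of_eventuallyEq ?_
      filter_upwards [hnhds v₂ t ht0 hre] with t' ht' using hY₂ t' ht'
  · obtain ⟨ht0, h | h⟩ := ht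
    · simp only [hY₁ t (hpos v₁ t ht0 h)]
      exact hest v₁ hn₁ hv₁ t ht0 ht1 h N
    · simp only [hY₂ t (hpos v₂ t ht0 h)]
      exact hest v₂ hn₂ hv₂ t ht0 ht1 h N

end MonomialSummability

/-! ### From one-variable Gevrey families to an expansion in the monomial -/

namespace MonomialSummability

open Set Metric Filter Topology

variable {E : Type*} [NormedAddCommGroup E] [NormedSpace ℂ E]

/-- The exponent of `x₁^n x₂^m`. -/
noncomputable def expo (n m : ℕ) : Fin 2 →₀ ℕ := Finsupp.single 0 n + Finsupp.single 1 m

@[simp] theorem expo_zero (n m : ℕ) : expo n m 0 = n := by simp [expo]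

@[simp] theorem expo_one (n m : ℕ) : expo n m 1 = m := by simp [expo]

theorem bideg_expo (n m : ℕ) : bideg (expo n m) = n + m := by simp [bideg]

theorem bideg_nsmul (e : ℕ) (k : Fin 2 →₀ ℕ) : bideg (e • k) = e * bideg k := by
  simp [bideg, mul_add]

/-- The `n`-th coefficient of the series `∑ t^e W_{k+eκ}` when `W_k = ∑ F_{n,k} t^n`. -/
noncomputable def foldedCoeff {V : Type*} [AddCommMonoid V] (F : ℕ → (Fin 2 →₀ ℕ) → V)
    (κ k : Fin 2 →₀ ℕ) (n : ℕ) : V :=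
  ∑ e ∈ Finset.range (n + 1), F (n - e) (k + e • κ)

/-- Summation of a Gevrey family along multiples of the exponent `κ`. -/
theorem exists_folded_sum [CompleteSpace E] {S : Set ℂ} (hS : IsOpen S)
    {W : (Fin 2 →₀ ℕ) → ℂ → E} {F : ℕ → (Fin 2 →₀ ℕ) → E} {K A Q τ : ℝ} (hK : 0 ≤ K) (hA : 0 < A)
    (hQ : 0 < Q) (κ : Fin 2 →₀ ℕ) (hτ : τ * Q ^ bideg κ ≤ 1 / 2)
    (hτ1 : τ ≤ 1) (hW : ∀ k, DifferentiableOn ℂ (W k) S)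
    (hest : ∀ k, ∀ t ∈ S, ‖t‖ ≤ 1 → ∀ N : ℕ, ‖W k t - ∑ n ∈ Finset.range N, t ^ n • F n k‖ ≤
      K * Q ^ bideg k * A ^ N * N.factorial * ‖t‖ ^ N) :
    ∃ Z : (Fin 2 →₀ ℕ) → ℂ → E, (∀ k, DifferentiableOn ℂ (Z k) (S ∩ ball 0 τ)) ∧
      ∀ k, ∀ t ∈ S ∩ ball 0 τ, ∀ N : ℕ,
        ‖Z k t - ∑ n ∈ Finset.range N, t ^ n • foldedCoeff F κ k n‖ ≤
          2 * K * Q ^ bideg k * (A + 2 * Q ^ bideg κ) ^ N * N.factorial * ‖t‖ ^ N := by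
  set D := Q ^ bideg κ with hD
  have hD0 : 0 < D := by positivity
  have hdeg : ∀ k e, Q ^ bideg (k + e • κ) = Q ^ bideg k * D ^ e := by
    intro k e
    rw [bideg_add, bideg_nsmul, pow_add, hD, ← pow_mul, mul_comm e]
  -- The factor t^e supplies e orders, so W is expanded only to order N - e. Writing D^e = (2D)^e
  -- (1/2)^e makes the sum over e converge.
  have hterm : ∀ k, ∀ t ∈ S ∩ ball 0 τ, ∀ N e : ℕ,
      ‖t ^ e • (W (k + e • κ) t - ∑ n ∈ Finset.range (N - e), t ^ n • F n (k + e • κ))‖ ≤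
        K * Q ^ bideg k * (A + 2 * D) ^ N * N.factorial * ‖t‖ ^ N * (1 / 2) ^ e := by
    intro k t ht N e
    have htτ : ‖t‖ < τ := by simpa using ht.2
    have htD : ‖t‖ * D ≤ 1 / 2 := le_trans (by gcongr) hτ
    have h := hest (k + e • κ) t ht.1 (htτ.le.trans hτ1) (N - e)
    rw [norm_smul, norm_pow]
    rcases le_or_gt e N with he | he
    · have hfac : ((N - e).factorial : ℝ) ≤ N.factorial := by
        exact_mod_cast Nat.factorial_le (Nat.sub_le N e)
      calc _ ≤ ‖t‖ ^ e * (K * Q ^ bideg (k + e • κ) * A ^ (N - e) * (N - e).factorial *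
              ‖t‖ ^ (N - e)) := by gcongr
        _ = K * Q ^ bideg k * (A ^ (N - e) * (2 * D) ^ e) * (N - e).factorial *
              (‖t‖ ^ (N - e) * ‖t‖ ^ e) * (1 / 2) ^ e := by
            rw [hdeg, mul_pow, div_pow, one_pow]
            field_simp
        _ ≤ K * Q ^ bideg k * ((A + 2 * D) ^ (N - e) * (A + 2 * D) ^ e) * N.factorial *
              (‖t‖ ^ (N - e) * ‖t‖ ^ e) * (1 / 2) ^ e := by
            gcongr
            · linarith
            · linarith
        _ = _ := by rw [← pow_add, ← pow_add, Nat.sub_add_cancel he]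
    -- Here N - e truncates to 0 and W itself is bounded; the surplus powers of t are used through
    -- |t| D ≤ 1/2.
    · obtain ⟨j, rfl⟩ := Nat.exists_eq_add_of_lt he
      rw [Nat.sub_eq_zero_of_le he.le] at h ⊢
      have hfac : (1 : ℝ) ≤ N.factorial := by exact_mod_cast N.factorial_pos
      have e1 : N + j + 1 = N + (j + 1) := by ring
      have e2 : (1 / 2 : ℝ) ^ (j + 1) = 2 ^ N * (1 / 2) ^ (N + (j + 1)) := by
        rw [pow_add _ N, ← mul_assoc, ← mul_pow]; norm_num
      calc _ ≤ ‖t‖ ^ (N + j + 1) * (K * Q ^ bideg (k + (N + j + 1) • κ) * A ^ 0 *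
              (Nat.factorial 0) * ‖t‖ ^ 0) := by gcongr
        _ = K * Q ^ bideg k * D ^ N * ‖t‖ ^ N * (‖t‖ * D) ^ (j + 1) := by
            rw [hdeg, e1, pow_add, pow_add, mul_pow]; simp; ring
        _ ≤ K * Q ^ bideg k * D ^ N * ‖t‖ ^ N * (1 / 2) ^ (j + 1) := by gcongr
        _ = K * Q ^ bideg k * (2 * D) ^ N * 1 * ‖t‖ ^ N * (1 / 2) ^ (N + j + 1) := by
            rw [e1, e2, mul_pow]; ring
        _ ≤ _ := by gcongr; linarith
  have hzero : ∀ k, ∀ t ∈ S ∩ ball 0 τ, ∀ e : ℕ,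
      ‖t ^ e • W (k + e • κ) t‖ ≤ K * Q ^ bideg k * (1 / 2) ^ e := by
    intro k t ht e
    simpa using hterm k t ht 0 e
  have hsumm : ∀ k, Summable fun e : ℕ => K * Q ^ bideg k * (1 / 2 : ℝ) ^ e := fun k =>
    summable_geometric_two.mul_left _
  refine ⟨fun k t => ∑' e : ℕ, t ^ e • W (k + e • κ) t, fun k => ?_, fun k t ht N => ?_⟩
  · refine differentiableOn_tsum_of_norm_le (hS.inter isOpen_ball) (hsumm k) (fun e => ?_)
      (fun e t ht => hzero k t ht e)
    exact DifferentiableOn.smul (by fun_prop) ((hW _).mono inter_subset_left)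
  · have h1 : HasSum (fun e : ℕ => t ^ e • W (k + e • κ) t) (∑' e : ℕ, t ^ e • W (k + e • κ) t) :=
      (Summable.of_norm_bounded (hsumm k) (hzero k t ht)).hasSum
    have h2 : HasSum (fun e : ℕ => t ^ e • ∑ n ∈ Finset.range (N - e), t ^ n • F n (k + e • κ))
        (∑ n ∈ Finset.range N, t ^ n • foldedCoeff F κ k n) := by
      have h3 : ∑ n ∈ Finset.range N, t ^ n • foldedCoeff F κ k n =
          ∑ e ∈ Finset.range N, t ^ e • ∑ n ∈ Finset.range (N - e), t ^ n • F n (k + e • κ) := by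
        simp only [Finset.smul_sum, smul_smul, ← pow_add]
        rw [← Finset.sum_range_diag_flip N fun e n => t ^ (e + n) • F n (k + e • κ)]
        refine Finset.sum_congr rfl fun n _ => ?_
        rw [foldedCoeff, Finset.smul_sum]
        refine Finset.sum_congr rfl fun e he => ?_
        rw [Nat.add_sub_cancel' (Nat.lt_succ_iff.1 (Finset.mem_range.1 he))]
      rw [h3]
      refine hasSum_sum_of_ne_finset_zero fun e he => ?_
      rw [Finset.mem_range, not_lt] at he
      simp [Nat.sub_eq_zero_of_le he]
    have h3 := h1.sub h2
    simp only [← smul_sub] at h3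
    have h4 := h3.norm_le_of_bounded (summable_geometric_two.mul_left _).hasSum
      (fun e => hterm k t ht N e)
    refine h4.trans (le_of_eq ?_)
    rw [tsum_mul_left, tsum_geometric_two]
    ring

theorem isOpen_polydisc (p q : ℕ) (r : ℝ) : IsOpen (polydisc p q r) :=
  (isOpen_lt (f := fun x : ℂ × ℂ => ‖x.1‖ ^ p) (by fun_prop) continuous_const).inter
    (isOpen_lt (f := fun x : ℂ × ℂ => ‖x.2‖ ^ q) (by fun_prop) continuous_const)

/-- A Gevrey family of one-variable functions defines a function of two variables with a Gevrey
expansion in the monomial. -/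
theorem exists_hasGevreyExpansion [CompleteSpace E] {p q : ℕ} (hp : 0 < p)
    {S : Set ℂ} (hS : IsOpen S)
    {W : (Fin 2 →₀ ℕ) → ℂ → E} {F : ℕ → (Fin 2 →₀ ℕ) → E} {K A Q : ℝ} (hK : 0 ≤ K) (hA : 0 < A)
    (hQ : 0 < Q) (hW : ∀ k, DifferentiableOn ℂ (W k) S)
    (hest : ∀ k, ∀ t ∈ S, ‖t‖ ≤ 1 → ∀ N : ℕ, ‖W k t - ∑ n ∈ Finset.range N, t ^ n • F n k‖ ≤
      K * Q ^ bideg k * A ^ N * N.factorial * ‖t‖ ^ N)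
    (hF : ∀ n k, ‖F n k‖ ≤ K * Q ^ bideg k * A ^ n * n.factorial) {a : ℕ → ℕ → E}
    (ha : ∀ n m j : ℕ, m < p ∨ j < q →
      a (n * p + m) (n * q + j) = foldedCoeff F (expo p q) (expo m j) n)
    {α β : ℝ} (hsec : ∀ r, ∀ x ∈ sector p q α β r, x.1 ^ p * x.2 ^ q ∈ S) :
    ∃ r : ℝ, 0 < r ∧ ∃ f : ℂ × ℂ → E, DifferentiableOn ℂ f (sector p q α β r) ∧
      HasGevreyExpansion p q 1 f a α β r := by
  -- For |x₁|, |x₂| ≤ h the monomial series are dominated by geometric ones of ratio 1/2, and |t| ≤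
  -- h^(p+q) satisfies the smallness condition of `exists_folded_sum`.
  set h : ℝ := min (1 / (2 * Q)) 1 with hh
  have hh0 : 0 < h := by positivity
  have hh1 : h ≤ 1 := min_le_right _ _
  have hhQ : h * Q ≤ 1 / 2 := by
    calc h * Q ≤ 1 / (2 * Q) * Q := by gcongr; exact min_le_left _ _
      _ = 1 / 2 := by field_simp
  have hτ : h ^ (p + q) * Q ^ bideg (expo p q) ≤ 1 / 2 := by
    rw [bideg_expo, ← mul_pow]
    exact (pow_le_of_le_one (by positivity) (hhQ.trans (by norm_num)) (by omega)).trans hhQ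
  obtain ⟨Z, hZd, hZ⟩ := exists_folded_sum hS hK hA hQ (expo p q) hτ
    (pow_le_one₀ hh0.le hh1) hW hest
  set A' := A + 2 * Q ^ bideg (expo p q) with hA'
  have hA'0 : 0 < A' := by positivity
  let r : ℝ := min (h ^ p) (h ^ q)
  have hr0 : 0 < r := by positivity
  have hx : ∀ x ∈ polydisc p q r, ‖x.1‖ ≤ h ∧ ‖x.2‖ ≤ h ∧ ‖x.1‖ ^ p < h ^ p ∧
      ‖x.2‖ ^ q < h ^ q := by
    intro x hx
    have h1 : ‖x.1‖ ^ p < h ^ p := hx.1.trans_le (min_le_left _ _)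
    have h2 : ‖x.2‖ ^ q < h ^ q := hx.2.trans_le (min_le_right _ _)
    exact ⟨(lt_of_pow_lt_pow_left₀ p hh0.le h1).le, (lt_of_pow_lt_pow_left₀ q hh0.le h2).le, h1, h2⟩
  have hmon : ∀ x ∈ polydisc p q r, ∀ k : ℕ × ℕ,
      ‖x.1 ^ k.1 * x.2 ^ k.2‖ * Q ^ bideg (expo k.1 k.2) ≤ (1 / 2) ^ k.1 * (1 / 2) ^ k.2 := by
    intro x hxp k
    rw [norm_mul, norm_pow, norm_pow, bideg_expo, pow_add]
    calc _ = (‖x.1‖ * Q) ^ k.1 * (‖x.2‖ * Q) ^ k.2 := by rw [mul_pow, mul_pow]; ring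
      _ ≤ (h * Q) ^ k.1 * (h * Q) ^ k.2 := by
          gcongr
          · exact (hx x hxp).1
          · exact (hx x hxp).2.1
      _ ≤ _ := by gcongr
  have hgeo : Summable fun k : ℕ × ℕ => (1 / 2 : ℝ) ^ k.1 * (1 / 2 : ℝ) ^ k.2 :=
    summable_geometric_two.mul_of_nonneg summable_geometric_two (fun n => by positivity)
      fun n => by positivity
  set T : ℝ := ∑' k : ℕ × ℕ, (1 / 2 : ℝ) ^ k.1 * (1 / 2 : ℝ) ^ k.2 with hT
  have hT0 : 0 ≤ T := tsum_nonneg fun k => by positivity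
  have hbd : ∀ x ∈ polydisc p q r, ∀ k : ℕ × ℕ, ∀ (y : E) (B : ℝ), 0 ≤ B →
      ‖y‖ ≤ B * Q ^ bideg (expo k.1 k.2) →
      ‖if k.1 < p ∨ k.2 < q then (x.1 ^ k.1 * x.2 ^ k.2) • y else 0‖ ≤
        B * ((1 / 2) ^ k.1 * (1 / 2) ^ k.2) := by
    intro x hxp k y B hB hy
    split_ifs
    · rw [norm_smul]
      calc _ ≤ ‖x.1 ^ k.1 * x.2 ^ k.2‖ * (B * Q ^ bideg (expo k.1 k.2)) := by gcongr
        _ = B * (‖x.1 ^ k.1 * x.2 ^ k.2‖ * Q ^ bideg (expo k.1 k.2)) := by ring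
        _ ≤ _ := mul_le_mul_of_nonneg_left (hmon x hxp k) hB
    · rw [norm_zero]; positivity
  -- An open set containing all the sectors involved, on which f is holomorphic.
  let S' : Set (ℂ × ℂ) := polydisc p q r ∩ (fun x => x.1 ^ p * x.2 ^ q) ⁻¹' (S ∩ ball 0 (h ^ (p + q)))
  have hS' : IsOpen S' := (isOpen_polydisc p q r).inter
    ((hS.inter isOpen_ball).preimage (by fun_prop))
  have hsub : ∀ α' β' ρ, α ≤ α' → β' ≤ β → ρ ≤ r → sector p q α' β' ρ ⊆ S' := by
    rintro α' β' ρ hα hβ hρ x ⟨h1, h2, h3, θ, hθ, harg⟩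
    have hxp : x ∈ polydisc p q r := ⟨h3.1.trans_le hρ, h3.2.trans_le hρ⟩
    refine ⟨hxp, hsec r x ⟨h1, h2, hxp, θ, ⟨hα.trans_lt hθ.1, hθ.2.trans_le hβ⟩, harg⟩, ?_⟩
    rw [mem_ball_zero_iff, norm_mul, norm_pow, norm_pow, pow_add]
    obtain ⟨-, -, h5, h6⟩ := hx x hxp
    exact mul_lt_mul'' h5 h6 (by positivity) (by positivity)
  -- The sum runs only over reduced exponents; the others are already folded into Z as powers of t.
  let f : ℂ × ℂ → E := fun x => ∑' k : ℕ × ℕ, if k.1 < p ∨ k.2 < q then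
    (x.1 ^ k.1 * x.2 ^ k.2) • Z (expo k.1 k.2) (x.1 ^ p * x.2 ^ q) else 0
  have hZ0 : ∀ k, ∀ t ∈ S ∩ ball 0 (h ^ (p + q)), ‖Z k t‖ ≤ 2 * K * Q ^ bideg k := by
    intro k t ht
    simpa using hZ k t ht 0
  let g : ℕ → ℂ × ℂ → E := fun n x => ∑' k : ℕ × ℕ, if k.1 < p ∨ k.2 < q then
    (x.1 ^ k.1 * x.2 ^ k.2) • a (n * p + k.1) (n * q + k.2) else 0
  let c : ℕ → ℝ := fun n => ∑ e ∈ Finset.range (n + 1),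
    K * (Q ^ bideg (expo p q)) ^ e * A ^ (n - e) * (n - e).factorial
  have hc0 : ∀ n, 0 ≤ c n := fun n => Finset.sum_nonneg fun e _ => by positivity
  have hcoeff : ∀ n (k : ℕ × ℕ), ‖foldedCoeff F (expo p q) (expo k.1 k.2) n‖ ≤
      c n * Q ^ bideg (expo k.1 k.2) := by
    intro n k
    rw [foldedCoeff, Finset.sum_mul]
    refine norm_sum_le_of_le _ fun e _ => (hF _ _).trans (le_of_eq ?_)
    rw [bideg_add, bideg_nsmul, pow_add, mul_comm e, pow_mul]
    ring
  have hgterm : ∀ n, ∀ x ∈ polydisc p q r, ∀ k : ℕ × ℕ, ‖if k.1 < p ∨ k.2 < q then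
      (x.1 ^ k.1 * x.2 ^ k.2) • a (n * p + k.1) (n * q + k.2) else 0‖ ≤
        c n * ((1 / 2) ^ k.1 * (1 / 2) ^ k.2) := by
    intro n x hxp k
    have := hbd x hxp k _ _ (hc0 n) (hcoeff n k)
    by_cases hk : k.1 < p ∨ k.2 < q
    · rwa [if_pos hk, ← ha n k.1 k.2 hk, ← if_pos (c := k.1 < p ∨ k.2 < q)
        (t := (x.1 ^ k.1 * x.2 ^ k.2) • a (n * p + k.1) (n * q + k.2)) (e := (0 : E)) hk] at this
    · rw [if_neg hk] at this ⊢
      exact this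
  have hgsum : ∀ n, ∀ x ∈ polydisc p q r, HasSum (fun k : ℕ × ℕ => if k.1 < p ∨ k.2 < q then
      (x.1 ^ k.1 * x.2 ^ k.2) • a (n * p + k.1) (n * q + k.2) else 0) (g n x) := fun n x hxp =>
    (Summable.of_norm_bounded (hgeo.mul_left (c n)) (hgterm n x hxp)).hasSum
  refine ⟨r, hr0, f, ?_, r, hr0, le_rfl, g, fun n => ⟨?_, ⟨c n * T, fun x hxp => ?_⟩,
    hgsum n⟩, ?_⟩
  · refine DifferentiableOn.mono ?_ (hsub α β r le_rfl le_rfl le_rfl)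
    refine differentiableOn_tsum_of_norm_le hS' (hgeo.mul_left (2 * K)) (fun k => ?_)
      fun k x hxS => hbd x hxS.1 k _ _ (by positivity) (hZ0 _ _ hxS.2)
    split_ifs
    · refine DifferentiableOn.smul (by fun_prop) ?_
      exact (hZd _).comp (by fun_prop) fun x hxS => hxS.2
    · exact differentiableOn_const _
  · refine differentiableOn_tsum_of_norm_le (isOpen_polydisc p q r) (hgeo.mul_left (c n))
      (fun k => ?_) fun k x hxp => hgterm n x hxp k
    split_ifs
    · exact DifferentiableOn.smul_const (by fun_prop) _
    · exact differentiableOn_const _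
  · exact (hgsum n x hxp).norm_le_of_bounded (hgeo.hasSum.mul_left (c n)) (hgterm n x hxp)
  · intro α' β' ρ hα _ hβ _ hρ
    refine ⟨2 * K * T + 1, A', by positivity, hA'0, fun N x hxs => ?_⟩
    have hxS := hsub α' β' ρ hα.le hβ.le hρ.le hxs
    set t := x.1 ^ p * x.2 ^ q with ht
    have hf : HasSum (fun k : ℕ × ℕ => if k.1 < p ∨ k.2 < q then
        (x.1 ^ k.1 * x.2 ^ k.2) • Z (expo k.1 k.2) t else 0) (f x) :=
      (Summable.of_norm_bounded (hgeo.mul_left (2 * K)) fun k =>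
        hbd x hxS.1 k _ _ (by positivity) (hZ0 _ _ hxS.2)).hasSum
    have hg := hasSum_sum (s := Finset.range N) fun n _ => (hgsum n x hxS.1).const_smul (t ^ n)
    have hfg := hf.sub hg
    have hkey : ∀ k : ℕ × ℕ, ((if k.1 < p ∨ k.2 < q then
        (x.1 ^ k.1 * x.2 ^ k.2) • Z (expo k.1 k.2) t else 0) -
        ∑ n ∈ Finset.range N, t ^ n • if k.1 < p ∨ k.2 < q then
          (x.1 ^ k.1 * x.2 ^ k.2) • a (n * p + k.1) (n * q + k.2) else 0) =
        if k.1 < p ∨ k.2 < q then (x.1 ^ k.1 * x.2 ^ k.2) • (Z (expo k.1 k.2) t -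
          ∑ n ∈ Finset.range N, t ^ n • foldedCoeff F (expo p q) (expo k.1 k.2) n) else 0 := by
      intro k
      by_cases hk : k.1 < p ∨ k.2 < q
      · simp only [if_pos hk]
        rw [smul_sub, Finset.smul_sum]
        congr 1
        refine Finset.sum_congr rfl fun n _ => ?_
        rw [ha n k.1 k.2 hk, smul_comm]
      · simp [if_neg hk]
    have := hfg.norm_le_of_bounded
      (hgeo.hasSum.mul_left (2 * K * A' ^ N * N.factorial * ‖t‖ ^ N)) (fun k => by
        rw [hkey]
        refine hbd x hxS.1 k _ _ (by positivity) ((hZ _ _ hxS.2 N).trans (le_of_eq ?_))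
        ring)
    refine this.trans ?_
    rw [Real.rpow_one]
    calc _ = (2 * K * T) * A' ^ N * N.factorial * ‖t‖ ^ N := by ring
      _ ≤ _ := by gcongr; linarith

end MonomialSummability

/-! ### The formal equation and its unique solution -/

namespace MonomialSummability

open Set Metric Filter Topology

variable {E : Type*} [NormedAddCommGroup E] [NormedSpace ℂ E]

/-- The eigenvalue of the Euler operator `(s/p) x₁ ∂₁ + ((1-s)/q) x₂ ∂₂` on the monomial `x^k`. -/
noncomputable def eulerWeight (p q : ℕ) (s : ℝ) (k : Fin 2 →₀ ℕ) : ℝ :=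
  s / p * k 0 + (1 - s) / q * k 1

theorem eulerWeight_add (p q : ℕ) (s : ℝ) (j k : Fin 2 →₀ ℕ) :
    eulerWeight p q s (j + k) = eulerWeight p q s j + eulerWeight p q s k := by
  simp [eulerWeight]; ring

theorem eulerWeight_nonneg (p q : ℕ) {s : ℝ} (hs₀ : 0 ≤ s) (hs₁ : s ≤ 1) (k : Fin 2 →₀ ℕ) :
    0 ≤ eulerWeight p q s k := by
  have : 0 ≤ 1 - s := by linarith
  rw [eulerWeight]; positivity

theorem eulerWeight_le (p q : ℕ) {s : ℝ} (hp : 0 < p) (hq : 0 < q) (hs₀ : 0 ≤ s) (hs₁ : s ≤ 1)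
    (k : Fin 2 →₀ ℕ) : eulerWeight p q s k ≤ bideg k := by
  have hp' : (1 : ℝ) ≤ p := by exact_mod_cast hp
  have hq' : (1 : ℝ) ≤ q := by exact_mod_cast hq
  have h1 : s / p ≤ 1 := by rw [div_le_one (by linarith)]; linarith
  have h2 : (1 - s) / q ≤ 1 := by rw [div_le_one (by linarith)]; linarith
  rw [eulerWeight, bideg]
  push_cast
  have h3 := mul_le_of_le_one_left (Nat.cast_nonneg (α := ℝ) (k 0)) h1
  have h4 := mul_le_of_le_one_left (Nat.cast_nonneg (α := ℝ) (k 1)) h2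
  linarith

theorem eulerWeight_expo {p q : ℕ} (hp : 0 < p) (hq : 0 < q) (s : ℝ) :
    eulerWeight p q s (expo p q) = 1 := by
  have hp' : (p : ℝ) ≠ 0 := by exact_mod_cast hp.ne'
  have hq' : (q : ℝ) ≠ 0 := by exact_mod_cast hq.ne'
  simp only [eulerWeight, expo_zero, expo_one]
  field_simp
  ring

theorem eulerWeight_nsmul (p q : ℕ) (s : ℝ) (e : ℕ) (k : Fin 2 →₀ ℕ) :
    eulerWeight p q s (e • k) = e * eulerWeight p q s k := by
  simp [eulerWeight]; ring

theorem coeff_X_mul_pderiv (i : Fin 2) (f : MvPowerSeries (Fin 2) ℂ) (k : Fin 2 →₀ ℕ) :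
    MvPowerSeries.coeff k (MvPowerSeries.X i * MvPowerSeries.pderiv ℂ i f) =
      (k i : ℂ) * MvPowerSeries.coeff k f := by
  rw [MvPowerSeries.X, MvPowerSeries.coeff_monomial_mul]
  split_ifs with h
  · rw [MvPowerSeries.coeff_pderiv, one_mul, tsub_add_cancel_of_le h, mul_comm]
    congr 1
    have : 1 ≤ k i := by simpa using h i
    rw [Finsupp.tsub_apply, Finsupp.single_eq_same, Nat.cast_sub this]
    simp
  · have : k i = 0 := by
      by_contra hk
      exact h (Finsupp.single_le_iff.2 (Nat.one_le_iff_ne_zero.2 hk))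
    simp [this]

theorem X_pow_mul_X_pow (p q : ℕ) : (MvPowerSeries.X 0 ^ p * MvPowerSeries.X 1 ^ q :
    MvPowerSeries (Fin 2) ℂ) = MvPowerSeries.monomial (expo p q) 1 := by
  rw [MvPowerSeries.X_pow_eq, MvPowerSeries.X_pow_eq, MvPowerSeries.monomial_mul_monomial, one_mul,
    expo]

/-- The Taylor coefficients of a matrix of functions, as operators. -/
noncomputable def taylorMap {l : ℕ} (C : ℂ × ℂ → Matrix (Fin l) (Fin l) ℂ) (k : Fin 2 →₀ ℕ) :
    (Fin l → ℂ) →L[ℂ] (Fin l → ℂ) :=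
  LinearMap.toContinuousLinearMap (Matrix.toLin' (Matrix.of fun i j =>
    MvPowerSeries.coeff k (taylorSeries fun x => C x i j)))

theorem taylorMap_apply {l : ℕ} (C : ℂ × ℂ → Matrix (Fin l) (Fin l) ℂ) (k : Fin 2 →₀ ℕ)
    (y : Fin l → ℂ) (i : Fin l) :
    taylorMap C k y i = ∑ j, MvPowerSeries.coeff k (taylorSeries fun x => C x i j) * y j := by
  simp [taylorMap, Matrix.mulVec, dotProduct]

/-- The equation for the coefficients of a formal solution. -/
theorem isFormalSolution_iff {l : ℕ} (p q : ℕ) (s : ℝ) (C : ℂ × ℂ → Matrix (Fin l) (Fin l) ℂ)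
    (γ : ℂ × ℂ → Fin l → ℂ) (y : Fin l → MvPowerSeries (Fin 2) ℂ) :
    IsFormalSolution p q s C γ y ↔ ∀ k : Fin 2 →₀ ℕ,
      (if expo p q ≤ k then ((eulerWeight p q s (k - expo p q) : ℝ) : ℂ) •
        (fun i => MvPowerSeries.coeff (k - expo p q) (y i)) else 0) =
      ∑ x ∈ Finset.HasAntidiagonal.antidiagonal k,
        taylorMap C x.1 (fun i => MvPowerSeries.coeff x.2 (y i)) +
        fun i => MvPowerSeries.coeff k (taylorSeries fun x => γ x i) := by
  have key : ∀ (k : Fin 2 →₀ ℕ) (i : Fin l), MvPowerSeries.coeff k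
      ((MvPowerSeries.X 0 ^ p * MvPowerSeries.X 1 ^ q) *
      (((s : ℂ) / (p : ℂ)) • (MvPowerSeries.X 0 * MvPowerSeries.pderiv ℂ 0 (y i)) +
        ((1 - (s : ℂ)) / (q : ℂ)) • (MvPowerSeries.X 1 * MvPowerSeries.pderiv ℂ 1 (y i)))) =
      if expo p q ≤ k then ((eulerWeight p q s (k - expo p q) : ℝ) : ℂ) *
        MvPowerSeries.coeff (k - expo p q) (y i) else 0 := by
    intro k i
    rw [X_pow_mul_X_pow, MvPowerSeries.coeff_monomial_mul]
    split_ifs with h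
    · rw [one_mul, map_add, MvPowerSeries.coeff_smul, MvPowerSeries.coeff_smul, coeff_X_mul_pderiv,
        coeff_X_mul_pderiv, eulerWeight]
      push_cast
      ring
    · rfl
  have key2 : ∀ (k : Fin 2 →₀ ℕ) (i : Fin l), MvPowerSeries.coeff k
      (∑ j : Fin l, taylorSeries (fun x => C x i j) * y j + taylorSeries (fun x => γ x i)) =
      (∑ x ∈ Finset.HasAntidiagonal.antidiagonal k,
        taylorMap C x.1 (fun i => MvPowerSeries.coeff x.2 (y i)) +
        fun i => MvPowerSeries.coeff k (taylorSeries fun x => γ x i)) i := by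
    intro k i
    rw [map_add, map_sum, Pi.add_apply, Finset.sum_apply]
    simp only [MvPowerSeries.coeff_mul, taylorMap_apply]
    rw [Finset.sum_comm]
  constructor
  · intro h k
    ext i
    rw [← key2, ← h i, key]
    split_ifs <;> simp
  · intro h i
    ext k
    rw [key, key2, ← h k]
    split_ifs <;> simp

/-- Multiplication by the monomial x^κ commutes with convolution by φ. -/
theorem sum_antidiagonal_shift (φ : (Fin 2 →₀ ℕ) → E →L[ℂ] E) (G : (Fin 2 →₀ ℕ) → E)
    (κ k : Fin 2 →₀ ℕ) :
    ∑ x ∈ Finset.HasAntidiagonal.antidiagonal k, φ x.1 (if κ ≤ x.2 then G (x.2 - κ) else 0) =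
      if κ ≤ k then ∑ x ∈ Finset.HasAntidiagonal.antidiagonal (k - κ), φ x.1 (G x.2) else 0 := by
  split_ifs with h
  · symm
    refine Finset.sum_of_injOn (fun x => (x.1, x.2 + κ)) ?_ ?_ ?_ ?_
    · rintro ⟨a, b⟩ - ⟨c, d⟩ - hab
      simpa using hab
    · rintro ⟨a, b⟩ hab
      simp only [Finset.mem_coe, Finset.HasAntidiagonal.mem_antidiagonal] at hab ⊢
      rw [← add_assoc, hab, tsub_add_cancel_of_le h]
    · rintro ⟨a, b⟩ hab hnot
      rw [Finset.HasAntidiagonal.mem_antidiagonal] at hab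
      have : ¬ κ ≤ b := by
        intro hb
        refine hnot ⟨(a, b - κ), ?_, ?_⟩
        · simp only [Finset.mem_coe, Finset.HasAntidiagonal.mem_antidiagonal]
          rw [← add_tsub_assoc_of_le hb, hab]
        · simp [tsub_add_cancel_of_le hb]
      simp [this]
    · rintro ⟨a, b⟩ -
      simp
  · refine Finset.sum_eq_zero fun x hx => ?_
    rw [Finset.HasAntidiagonal.mem_antidiagonal] at hx
    have : ¬ κ ≤ x.2 := fun h' => h (h'.trans (hx ▸ le_add_self))
    simp [this]

/-- The coefficients of `∑ t^e ∑ F_{e,k} x^k` with `t = x^κ`. -/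
noncomputable def unfoldedCoeff {V : Type*} [AddCommMonoid V] (F : ℕ → (Fin 2 →₀ ℕ) → V)
    (κ k : Fin 2 →₀ ℕ) : V :=
  ∑ e ∈ Finset.range (k 0 + 1), if e • κ ≤ k then F e (k - e • κ) else 0

theorem unfoldedCoeff_eq_sum_range {V : Type*} [AddCommMonoid V] {F : ℕ → (Fin 2 →₀ ℕ) → V}
    {κ k : Fin 2 →₀ ℕ} (hκ : 0 < κ 0) {N : ℕ} (hN : k 0 < N) :
    unfoldedCoeff F κ k = ∑ e ∈ Finset.range N, if e • κ ≤ k then F e (k - e • κ) else 0 := by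
  refine Finset.sum_subset (Finset.range_mono hN) fun e _ he => if_neg fun hle => he ?_
  have := hle 0
  rw [Finsupp.smul_apply, smul_eq_mul] at this
  rw [Finset.mem_range]
  nlinarith

/-- The condition m < p or j < q says that at most n copies of κ can be removed from the exponent,
so terms with e > n vanish. The remaining terms match after the reversal e ↦ n - e. -/
theorem unfoldedCoeff_add {V : Type*} [AddCommMonoid V] {F : ℕ → (Fin 2 →₀ ℕ) → V} {p q : ℕ}
    (hp : 0 < p) (n m j : ℕ) (hmj : m < p ∨ j < q) : unfoldedCoeff F (expo p q) (expo (n * p + m) (n * q + j)) =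
      foldedCoeff F (expo p q) (expo m j) n := by
  have hsplit : expo (n * p + m) (n * q + j) = expo m j + n • expo p q := by
    ext i
    fin_cases i <;> simp <;> ring
  have hn : n ≤ n * p + m := by nlinarith
  rw [unfoldedCoeff, foldedCoeff, ← Finset.sum_range_reflect _ (n + 1)]
  symm
  refine Finset.sum_subset_zero_on_sdiff (Finset.range_mono (by simpa using hn)) ?_ ?_
  · intro e he
    rw [Finset.mem_sdiff, Finset.mem_range, Finset.mem_range] at he
    refine if_neg fun hle => ?_
    have h0 := hle 0
    have h1 := hle 1
    simp only [Finsupp.smul_apply, expo_zero, expo_one, smul_eq_mul] at h0 h1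
    obtain ⟨d, rfl⟩ : ∃ d, e = n + 1 + d := ⟨e - (n + 1), by omega⟩
    rcases hmj with h | h <;> nlinarith
  · intro e he
    have he' : e ≤ n := Nat.lt_succ_iff.1 (Finset.mem_range.1 he)
    have h1 : n + 1 - 1 - e = n - e := by omega
    have h2 : n - (n - e) = e := by omega
    have h3 : expo (n * p + m) (n * q + j) = (expo m j + (n - e) • expo p q) + e • expo p q := by
      rw [hsplit, add_assoc, ← add_smul, Nat.sub_add_cancel he']
    rw [h1, h2, h3, if_pos le_add_self, add_tsub_cancel_right]

/-- The recursion in the extra variable `t` yields the equation for the formal solution. -/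
theorem unfoldedCoeff_equation {F : ℕ → (Fin 2 →₀ ℕ) → E} {p q : ℕ} (hp : 0 < p) (hq : 0 < q)
    {s : ℝ} {C : (Fin 2 →₀ ℕ) → E →L[ℂ] E} {g : (Fin 2 →₀ ℕ) → E}
    (hF0 : ∀ k, ∑ x ∈ Finset.HasAntidiagonal.antidiagonal k, C x.1 (F 0 x.2) + g k = 0)
    (hF : ∀ n k, ∑ x ∈ Finset.HasAntidiagonal.antidiagonal k, C x.1 (F (n + 1) x.2) =
      ((n : ℂ) + eulerWeight p q s k) • F n k) (k : Fin 2 →₀ ℕ) :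
    (if expo p q ≤ k then ((eulerWeight p q s (k - expo p q) : ℝ) : ℂ) •
        unfoldedCoeff F (expo p q) (k - expo p q) else 0) =
      ∑ x ∈ Finset.HasAntidiagonal.antidiagonal k,
        C x.1 (unfoldedCoeff F (expo p q) x.2) + g k := by
  set κ := expo p q with hκ
  have hκ0 : 0 < κ 0 := by simpa [hκ] using hp
  have h1 : ∑ x ∈ Finset.HasAntidiagonal.antidiagonal k, C x.1 (unfoldedCoeff F κ x.2) =
      ∑ e ∈ Finset.range (k 0 + 1 + 1), if e • κ ≤ k then
        ∑ x ∈ Finset.HasAntidiagonal.antidiagonal (k - e • κ), C x.1 (F e x.2) else 0 := by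
    simp only [← sum_antidiagonal_shift]
    rw [Finset.sum_comm]
    refine Finset.sum_congr rfl fun x hx => ?_
    rw [Finset.HasAntidiagonal.mem_antidiagonal] at hx
    have hx0 : x.2 0 ≤ k 0 := by rw [← hx]; simp
    -- The range is one longer than needed, so that splitting off e = 0 leaves indices e + 1 with e
    -- ≤ k 0. The e = 0 term then cancels against g.
    rw [unfoldedCoeff_eq_sum_range hκ0 (N := k 0 + 1 + 1) (by omega), map_sum]
  rw [h1, Finset.sum_range_succ']
  have h2 := hF0 k
  simp only [zero_smul, zero_le, if_true, tsub_zero, hF]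
  rw [add_assoc, h2, add_zero]
  split_ifs with h
  · have hk0 : (k - κ) 0 < k 0 + 1 := by rw [Finsupp.tsub_apply]; omega
    rw [unfoldedCoeff_eq_sum_range hκ0 hk0, Finset.smul_sum]
    refine Finset.sum_congr rfl fun e _ => ?_
    have hiff : e • κ ≤ k - κ ↔ (e + 1) • κ ≤ k := by
      rw [le_tsub_iff_right h, add_smul, one_smul]
    have hsub : k - κ - e • κ = k - (e + 1) • κ := by
      rw [tsub_tsub, add_smul, one_smul, add_comm κ]
    by_cases he : (e + 1) • κ ≤ k
    · rw [if_pos he, if_pos (hiff.2 he), hsub]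
      congr 1
      have h3 : k - κ = (k - (e + 1) • κ) + e • κ := by
        rw [← hsub, tsub_add_cancel_of_le (hiff.2 he)]
      -- Since κ has Euler weight 1, the weight of k - κ is e plus that of k - (e + 1)κ: exactly the
      -- factor in the recursion for F.
      rw [h3, eulerWeight_add, eulerWeight_nsmul, hκ, eulerWeight_expo hp hq]
      push_cast
      ring
    · rw [if_neg he, if_neg (hiff.not.2 he), smul_zero]
  · symm
    refine Finset.sum_eq_zero fun e _ => if_neg fun he => h (le_trans ?_ he)
    rw [add_smul, one_smul]
    exact le_add_self

/-- Uniqueness of the formal solution. -/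
theorem IsFormalSolution.eq {l p q : ℕ} (hp : 0 < p) {s : ℝ}
    {C : ℂ × ℂ → Matrix (Fin l) (Fin l) ℂ} {γ : ℂ × ℂ → Fin l → ℂ}
    (hinj : Function.Injective (taylorMap C 0)) {y z : Fin l → MvPowerSeries (Fin 2) ℂ}
    (hy : IsFormalSolution p q s C γ y) (hz : IsFormalSolution p q s C γ z) : z = y := by
  rw [isFormalSolution_iff] at hy hz
  have key : ∀ n, ∀ k, bideg k = n → (fun i => MvPowerSeries.coeff k (z i)) =
      fun i => MvPowerSeries.coeff k (y i) := by
    intro n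
    induction n using Nat.strong_induction_on with
    | _ n ih =>
      intro k hk
      apply hinj
      have h1 := hy k
      have h2 := hz k
      rw [sum_antidiagonal_eq_add] at h1 h2
      -- Both the left-hand side and the convolution terms with x.1 ≠ 0 involve only coefficients of
      -- lower total degree; the former because κ has positive degree.
      have h3 : (if expo p q ≤ k then ((eulerWeight p q s (k - expo p q) : ℝ) : ℂ) •
          (fun i => MvPowerSeries.coeff (k - expo p q) (z i)) else 0) =
          (if expo p q ≤ k then ((eulerWeight p q s (k - expo p q) : ℝ) : ℂ) •
          (fun i => MvPowerSeries.coeff (k - expo p q) (y i)) else 0) := by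
        split_ifs with h
        · rw [ih _ ?_ _ rfl]
          have := bideg_add (k - expo p q) (expo p q)
          rw [tsub_add_cancel_of_le h, bideg_expo] at this
          omega
        · rfl
      have h4 : ∑ x ∈ Finset.HasAntidiagonal.antidiagonal k with x.1 ≠ 0,
          taylorMap C x.1 (fun i => MvPowerSeries.coeff x.2 (z i)) =
          ∑ x ∈ Finset.HasAntidiagonal.antidiagonal k with x.1 ≠ 0,
          taylorMap C x.1 (fun i => MvPowerSeries.coeff x.2 (y i)) := by
        refine Finset.sum_congr rfl fun x hx => ?_
        rw [Finset.mem_filter, Finset.HasAntidiagonal.mem_antidiagonal] at hx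
        rw [ih _ ?_ _ rfl]
        have := bideg_pos hx.2
        rw [← hk, ← hx.1, bideg_add]
        omega
      rw [h3, h4, h1] at h2
      exact (add_right_cancel (add_right_cancel h2)).symm
  ext i k
  exact congrFun (key _ k rfl) i

end MonomialSummability

/-! ### Cone domains in the Borel plane -/

namespace MonomialSummability

open Set Metric Filter Topology

variable {E : Type*} [NormedAddCommGroup E] [NormedSpace ℂ E]

/-- The component of `z` in the direction `d`. -/
noncomputable def dirRe (d : ℝ) (z : ℂ) : ℝ := (z * Complex.exp ((-d : ℝ) * Complex.I)).re

theorem dirRe_eq (d : ℝ) (z : ℂ) : dirRe d z = ‖z‖ * Real.cos (z.arg - d) := by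
  conv_lhs => rw [dirRe, ← Complex.norm_mul_exp_arg_mul_I z]
  rw [mul_assoc, ← Complex.exp_add, ← add_mul, ← Complex.ofReal_add, Complex.re_ofReal_mul,
    Complex.exp_ofReal_mul_I_re, sub_eq_add_neg]

theorem dirRe_sub (d : ℝ) (z w : ℂ) : dirRe d (z - w) = dirRe d z - dirRe d w := by
  simp only [dirRe, sub_mul, Complex.sub_re]

theorem dirRe_real_mul (d r : ℝ) (z : ℂ) : dirRe d (r * z) = r * dirRe d z := by
  rw [dirRe, mul_assoc, Complex.re_ofReal_mul, dirRe]

theorem abs_dirRe_le (d : ℝ) (z : ℂ) : |dirRe d z| ≤ ‖z‖ := by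
  refine (Complex.abs_re_le_norm _).trans ?_
  rw [norm_mul, Complex.norm_exp_ofReal_mul_I, mul_one]

theorem dirRe_exp (d θ : ℝ) : dirRe d (Complex.exp (θ * Complex.I)) = Real.cos (θ - d) := by
  rw [dirRe, ← Complex.exp_add, ← add_mul, ← Complex.ofReal_add, Complex.exp_ofReal_mul_I_re,
    sub_eq_add_neg]

theorem dirRe_lt_norm {d : ℝ} {μ : ℂ} (hμ : μ ≠ 0) (h : (d : Real.Angle) ≠ (μ.arg : Real.Angle)) :
    dirRe d μ < ‖μ‖ := by
  rw [dirRe_eq]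
  have h1 : Real.cos (μ.arg - d) ≠ 1 := by
    intro hc
    obtain ⟨n, hn⟩ := (Real.cos_eq_one_iff _).1 hc
    exact h (Real.Angle.angle_eq_iff_two_pi_dvd_sub.2 ⟨-n, by push_cast; linarith⟩)
  have h2 : Real.cos (μ.arg - d) < 1 := lt_of_le_of_ne (Real.cos_le_one _) h1
  exact mul_lt_of_lt_one_right (norm_pos_iff.2 hμ) h2

/-- A convex neighbourhood of a cone around the direction `d`. -/
def coneDomain (d κ ρ : ℝ) : Set ℂ := {ξ | κ * ‖ξ‖ - ρ < dirRe d ξ}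

theorem isOpen_coneDomain (d κ ρ : ℝ) : IsOpen (coneDomain d κ ρ) :=
  isOpen_lt (by fun_prop) (by unfold dirRe; fun_prop)

theorem convex_coneDomain {d κ ρ : ℝ} (hκ : 0 ≤ κ) : Convex ℝ (coneDomain d κ ρ) := by
  intro x hx y hy a b ha hb hab
  have hx' : κ * ‖x‖ - ρ < dirRe d x := hx
  have hy' : κ * ‖y‖ - ρ < dirRe d y := hy
  have h1 : dirRe d (a • x + b • y) = a * dirRe d x + b * dirRe d y := by
    rw [← dirRe_real_mul, ← dirRe_real_mul]
    simp only [dirRe, Complex.real_smul, add_mul, Complex.add_re]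
  have h2 : ‖a • x + b • y‖ ≤ a * ‖x‖ + b * ‖y‖ := by
    refine (norm_add_le _ _).trans (le_of_eq ?_)
    rw [norm_smul, norm_smul, Real.norm_of_nonneg ha, Real.norm_of_nonneg hb]
  change κ * ‖a • x + b • y‖ - ρ < dirRe d (a • x + b • y)
  rw [h1]
  have h3 : κ * ‖a • x + b • y‖ ≤ κ * (a * ‖x‖ + b * ‖y‖) := by gcongr
  have h4 : 0 < a * (dirRe d x - (κ * ‖x‖ - ρ)) + b * (dirRe d y - (κ * ‖y‖ - ρ)) := by
    rcases ha.eq_or_lt with rfl | ha'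
    · have : b = 1 := by linarith
      subst this
      linarith
    · have := mul_pos ha' (sub_pos.2 hx')
      have := mul_nonneg hb (sub_pos.2 hy').le
      linarith
  have h5 : ρ = a * ρ + b * ρ := by rw [← add_mul, hab, one_mul]
  nlinarith

/-- Points of the cone have component along d at least κ|ξ| up to a small constant, whereas μ has at
most κ₀|μ|. The gap κ - κ₀ separates ξ from μ by a distance proportional to 1 + |ξ|. -/
theorem isBorelDomain_coneDomain {d κ κ₀ m B : ℝ} {μ : ℂ} (h0 : 0 ≤ κ₀) (h1 : κ₀ < κ) (h2 : κ ≤ 1)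
    (hm : 0 < m) (hμm : m ≤ ‖μ‖) (hμB : ‖μ‖ ≤ B) (hμ : dirRe d μ ≤ κ₀ * ‖μ‖) :
    IsBorelDomain (coneDomain d κ ((κ - κ₀) * m / 4)) ((κ - κ₀) * min 1 (m / 2) / 4)
      ((B + 1) / ((κ - κ₀) * min 1 (m / 2) / 4)) μ := by
  have hκ : 0 < κ - κ₀ := by linarith
  have hmin : 0 < min 1 (m / 2) := by positivity
  have hδ : 0 < (κ - κ₀) * min 1 (m / 2) / 4 := by positivity
  have hμ0 : μ ≠ 0 := norm_pos_iff.1 (hm.trans_le hμm)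
  -- The estimate is proved for all points xμ with x ≥ 1: x = 1 is `le_norm_sub`, and the others
  -- exclude ξ/μ ∈ [1, ∞), which is the slit plane condition.
  have key : ∀ x : ℝ, 1 ≤ x → ∀ ξ ∈ coneDomain d κ ((κ - κ₀) * m / 4),
      (κ - κ₀) * min 1 (m / 2) / 4 * (1 + ‖ξ‖) ≤ ‖x * μ - ξ‖ := by
    intro x hx ξ hξ
    have hξ' : κ * ‖ξ‖ - (κ - κ₀) * m / 4 < dirRe d ξ := hξ
    set A := ‖x * μ - ξ‖ with hA
    have hA0 : 0 ≤ A := norm_nonneg _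
    have hnx : ‖(x : ℂ) * μ‖ = x * ‖μ‖ := by
      rw [norm_mul, Complex.norm_real, Real.norm_of_nonneg (by linarith)]
    have e1 : x * ‖μ‖ - ‖ξ‖ ≤ A := by rw [← hnx]; exact norm_sub_norm_le _ _
    have e2 : dirRe d ξ - x * dirRe d μ ≤ A := by
      rw [← dirRe_real_mul, ← dirRe_sub]
      refine (le_abs_self _).trans ((abs_dirRe_le _ _).trans (le_of_eq ?_))
      rw [hA, norm_sub_rev]
    have e3 : x * dirRe d μ ≤ x * (κ₀ * ‖μ‖) := by gcongr
    have e4 : κ * ‖ξ‖ - (κ - κ₀) * m / 4 - κ₀ * (x * ‖μ‖) ≤ A := by linarith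
    have e5 : m ≤ x * ‖μ‖ := hμm.trans (le_mul_of_one_le_left (norm_nonneg _) hx)
    -- Adding κ₀ times `e1` to `e4` eliminates x|μ|; adding κ times `e1` eliminates |ξ|. The sum of
    -- the two results gives the bound.
    have e6 : (κ - κ₀) * ‖ξ‖ - (κ - κ₀) * m / 4 ≤ (1 + κ₀) * A := by
      have := mul_le_mul_of_nonneg_left e1 h0
      nlinarith
    have e7 : (κ - κ₀) * m - (κ - κ₀) * m / 4 ≤ (1 + κ) * A := by
      have h3 := mul_le_mul_of_nonneg_left e1 (h0.trans h1.le)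
      have h4 := mul_le_mul_of_nonneg_left e5 hκ.le
      nlinarith
    have e8 : (2 + κ + κ₀) * A ≤ 4 * A := by gcongr; linarith
    have e9 : min 1 (m / 2) * ‖ξ‖ ≤ ‖ξ‖ := mul_le_of_le_one_left (norm_nonneg _) (min_le_left _ _)
    have e10 : min 1 (m / 2) ≤ m / 2 := min_le_right _ _
    have e11 : (κ - κ₀) * (min 1 (m / 2) * (1 + ‖ξ‖)) ≤ (κ - κ₀) * (m / 2 + ‖ξ‖) := by
      gcongr; linarith
    linarith
  refine ⟨isOpen_coneDomain _ _ _, convex_coneDomain (h0.trans h1.le), ?_, hδ, fun ξ hξ => ?_,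
    fun ξ hξ => ?_, ?_⟩
  · change κ * ‖(0 : ℂ)‖ - _ < dirRe d 0
    simp only [dirRe, norm_zero, mul_zero, zero_mul, Complex.zero_re, zero_sub, neg_lt_zero]
    positivity
  · simpa using key 1 le_rfl ξ hξ
  · rw [Complex.mem_slitPlane_iff]
    by_contra! hcon
    obtain ⟨hre, him⟩ := hcon
    simp only [Complex.sub_re, Complex.one_re, Complex.sub_im, Complex.one_im, zero_sub,
      neg_eq_zero] at hre him
    have hreal : ((ξ / μ).re : ℂ) = ξ / μ := Complex.ext rfl (by simp [him])
    have h3 := key (ξ / μ).re (by linarith) ξ hξ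
    rw [hreal, div_mul_cancel₀ _ hμ0, sub_self, norm_zero] at h3
    have : 0 < (κ - κ₀) * min 1 (m / 2) / 4 * (1 + ‖ξ‖) := by positivity
    linarith
  · rw [div_mul_cancel₀ _ hδ.ne']
    linarith

theorem exists_uniform_bounds {d : ℝ} (L : List ℂ) (hL : ∀ μ ∈ L, μ ≠ 0 ∧ dirRe d μ < ‖μ‖) :
    ∃ κ₀ m B : ℝ, 0 ≤ κ₀ ∧ κ₀ < 1 ∧ 0 < m ∧ 0 ≤ B ∧
      ∀ μ ∈ L, m ≤ ‖μ‖ ∧ ‖μ‖ ≤ B ∧ dirRe d μ ≤ κ₀ * ‖μ‖ := by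
  induction L with
  | nil => exact ⟨0, 1, 0, le_rfl, one_pos, one_pos, le_rfl, by simp⟩
  | cons ν L ih =>
    obtain ⟨κ₀, m, B, h0, h1, hm, hB, h⟩ := ih fun μ hμ => hL μ (List.mem_cons_of_mem _ hμ)
    obtain ⟨hν0, hν⟩ := hL ν List.mem_cons_self
    have hn := norm_pos_iff.2 hν0
    refine ⟨max κ₀ (dirRe d ν / ‖ν‖), min m ‖ν‖, max B ‖ν‖, le_max_of_le_left h0,
      max_lt h1 ((div_lt_one hn).2 hν), lt_min hm hn, le_max_of_le_left hB, ?_⟩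
    intro μ hμ
    rcases List.mem_cons.1 hμ with rfl | hμ
    · refine ⟨min_le_right _ _, le_max_right _ _, ?_⟩
      rw [← div_le_iff₀ hn]
      exact le_max_right _ _
    · obtain ⟨a, b, c⟩ := h μ hμ
      exact ⟨(min_le_left _ _).trans a, b.trans (le_max_left _ _),
        c.trans (by gcongr; exact le_max_left _ _)⟩

/-! ### Sectors in the monomial covered by two rays -/

theorem norm_mul_re_exp_div {t : ℂ} (ht : t ≠ 0) {φ : ℝ} (hφ : (t.arg : Real.Angle) = φ) (θ : ℝ) :
    ‖t‖ * (Complex.exp (θ * Complex.I) / t).re = Real.cos (θ - φ) := by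
  have hn := norm_pos_iff.2 ht
  have h1 : Complex.exp (θ * Complex.I) / t =
      ((‖t‖⁻¹ : ℝ) : ℂ) * Complex.exp (((θ - t.arg : ℝ) : ℂ) * Complex.I) := by
    conv_lhs => rw [← Complex.norm_mul_exp_arg_mul_I t]
    push_cast
    rw [sub_mul, Complex.exp_sub]
    field_simp
  rw [h1, Complex.re_ofReal_mul, Complex.exp_ofReal_mul_I_re, mul_inv_cancel_left₀ hn.ne']
  have hc : Real.cos t.arg = Real.cos φ := by
    have := congrArg Real.Angle.cos hφ
    simpa using this
  have hs : Real.sin t.arg = Real.sin φ := by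
    have := congrArg Real.Angle.sin hφ
    simpa using this
  rw [Real.cos_sub, Real.cos_sub, hc, hs]

/-- Any argument in the sector is within π/2 - η/2 of the nearer of d - η and d + η, and the cosine
there exceeds sin(η/2). The rays would allow opening π + 2η; only π + η is kept, to have this
uniform margin. -/
theorem mem_twoRaySector_of_mem_sector {p q : ℕ} {d η r : ℝ} (hη : 0 < η) (hη' : η < Real.pi / 4)
    {x : ℂ × ℂ} (hx : x ∈ sector p q (d - Real.pi / 2 - η / 2) (d + Real.pi / 2 + η / 2) r) :
    x.1 ^ p * x.2 ^ q ∈ twoRaySector (Complex.exp ((d - η : ℝ) * Complex.I))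
      (Complex.exp ((d + η : ℝ) * Complex.I)) (Real.sin (η / 2)) := by
  obtain ⟨h1, h2, -, φ, hφ, harg⟩ := hx
  have ht : x.1 ^ p * x.2 ^ q ≠ 0 := mul_ne_zero (pow_ne_zero _ h1) (pow_ne_zero _ h2)
  have hcos : ∀ u : ℝ, |u| < Real.pi / 2 - η / 2 → Real.sin (η / 2) < Real.cos u := by
    intro u hu
    rw [← Real.cos_abs u, ← Real.cos_pi_div_two_sub]
    exact Real.cos_lt_cos_of_nonneg_of_le_pi (abs_nonneg u) (by linarith [Real.pi_pos]) hu
  refine ⟨ht, ?_⟩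
  rw [norm_mul_re_exp_div ht harg, norm_mul_re_exp_div ht harg]
  rcases le_total φ d with h | h
  · refine Or.inl (hcos _ (abs_lt.2 ⟨?_, ?_⟩)) <;> linarith [hφ.1]
  · refine Or.inr (hcos _ (abs_lt.2 ⟨?_, ?_⟩)) <;> linarith [hφ.2]

/-- Borel summability of a family of Borel transforms gives 1-summability of the series in the
monomial. -/
theorem oneSummableInDirection_of_borel [CompleteSpace E] {p q : ℕ} (hp : 0 < p) {d η ρ M Q : ℝ}
    {Ω : Set ℂ} (hO : IsOpen Ω) (hconv : Convex ℝ Ω) (hρ : 0 < ρ) (hball : closedBall 0 ρ ⊆ Ω)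
    (hη : 0 < η) (hη' : η < Real.pi / 4)
    (hv₁ : ∀ r : ℝ, 0 ≤ r → r * Complex.exp ((d - η : ℝ) * Complex.I) ∈ Ω)
    (hv₂ : ∀ r : ℝ, 0 ≤ r → r * Complex.exp ((d + η : ℝ) * Complex.I) ∈ Ω)
    {U : (Fin 2 →₀ ℕ) → ℂ → E} (hM : 0 ≤ M) (hQ : 0 < Q) (hU : ∀ k, DifferentiableOn ℂ (U k) Ω)
    (hU0 : ∀ k, ‖U k 0‖ ≤ M * Q ^ bideg k)
    (hU1 : ∀ k, ∀ ξ ∈ Ω, ‖deriv (U k) ξ‖ ≤ M * Q ^ bideg k) {a : ℕ → ℕ → E}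
    (ha : ∀ n m, a n m =
      unfoldedCoeff (fun n k => iteratedDeriv n (U k) 0) (expo p q) (expo n m)) :
    OneSummableInDirection p q a d := by
  have hpi := Real.pi_pos
  set ε := Real.sin (η / 2) with hε
  have hε0 : 0 < ε := Real.sin_pos_of_pos_of_lt_pi (by linarith) (by linarith)
  have hε1 : ε ≤ 1 := Real.sin_le_one _
  have hW := fun k => exists_borel_sum hO hconv hρ hball (hU k) (hU0 k) (hU1 k)
    (Complex.norm_exp_ofReal_mul_I (d - η)) (Complex.norm_exp_ofReal_mul_I (d + η)) hv₁ hv₂ hε0 hε1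
  choose W hWd hWe using hW
  set A := (1 + 2 / ρ) / ε with hA
  have hA0 : 0 < A := by positivity
  have hFb : ∀ n k, ‖iteratedDeriv n (U k) 0‖ ≤ 4 * M / ε * Q ^ bideg k * A ^ n * n.factorial := by
    intro n k
    have h4 : M ≤ 4 * M / ε := by rw [le_div_iff₀ hε0]; nlinarith
    rcases n with _ | n
    · simp only [iteratedDeriv_zero, pow_zero, mul_one, Nat.factorial_zero, Nat.cast_one]
      exact (hU0 k).trans (by gcongr)
    · have h := Complex.norm_iteratedDeriv_le_of_forall_mem_sphere_norm_le n hρ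
        (((hU k).deriv hO).diffContOnCl_ball hball)
        (fun z hz => hU1 k z (hball (sphere_subset_closedBall hz)))
      rw [iteratedDeriv_succ']
      have hfac : (n.factorial : ℝ) ≤ (n + 1).factorial := by
        exact_mod_cast Nat.factorial_le n.le_succ
      have h1A : 1 + 2 / ρ ≤ A := by
        rw [hA, le_div_iff₀ hε0]
        exact mul_le_of_le_one_right (by positivity) hε1
      have h2ρ : 0 < 2 / ρ := by positivity
      have hρA : 1 / ρ ≤ A := by
        have : 1 / ρ ≤ 2 / ρ := by gcongr; norm_num
        linarith
      have hpow : (1 / ρ) ^ n ≤ A ^ (n + 1) :=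
        (pow_le_pow_left₀ (by positivity) hρA n).trans
          (pow_le_pow_right₀ (by linarith) n.le_succ)
      calc _ ≤ n.factorial * (M * Q ^ bideg k) / ρ ^ n := h
        _ = M * Q ^ bideg k * (1 / ρ) ^ n * n.factorial := by rw [one_div, inv_pow]; ring
        _ ≤ _ := by gcongr
  obtain ⟨r, hr, f, hf, hfe⟩ := exists_hasGevreyExpansion (p := p) (q := q) hp
    (isOpen_twoRaySector _ _ ε) (W := W) (F := fun n k => iteratedDeriv n (U k) 0)
    (K := 4 * M / ε) (A := A) (Q := Q) (by positivity) hA0 hQ hWd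
    (fun k t ht ht1 N => (hWe k t ht ht1 N).trans (le_of_eq (by ring))) hFb (a := a)
    (fun n m j hmj => by rw [ha]; exact unfoldedCoeff_add hp n m j hmj)
    (fun r x hx => mem_twoRaySector_of_mem_sector hη hη' hx)
  refine ⟨_, _, r, ?_, ?_, ?_, hr, f, hf, hfe⟩
  · ring
  · linarith
  · linarith

/-! ### Bounds on the data, Cayley-Hamilton and assembly -/

theorem exists_norm_taylorMap_le {l : ℕ} {r : ℝ} (hr : 0 < r)
    {C : ℂ × ℂ → Matrix (Fin l) (Fin l) ℂ} {γ : ℂ × ℂ → Fin l → ℂ}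
    (hC : ∀ i j, DifferentiableOn ℂ (fun x => C x i j) (ball 0 r ×ˢ ball 0 r))
    (hγ : ∀ i, DifferentiableOn ℂ (fun x => γ x i) (ball 0 r ×ˢ ball 0 r)) :
    ∃ A q : ℝ, 0 ≤ A ∧ 0 < q ∧ (∀ k, ‖taylorMap C k‖ ≤ A * q ^ bideg k) ∧
      ∀ k, ‖fun i => MvPowerSeries.coeff k (taylorSeries fun x => γ x i)‖ ≤ A * q ^ bideg k := by
  have hR : 0 < r / 2 := by positivity
  have hRr : r / 2 < r := by linarith
  choose a ha0 ha using fun i j => exists_norm_taylorSeries_le hR hRr (hC i j)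
  choose b hb0 hb using fun i => exists_norm_taylorSeries_le hR hRr (hγ i)
  have hpow : ∀ k : Fin 2 →₀ ℕ, ((r / 2 / 2) ^ (k 0 + k 1))⁻¹ = (4 / r) ^ bideg k := by
    intro k
    rw [bideg, ← inv_pow]
    congr 1
    field_simp
    norm_num
  simp only [hpow] at ha hb
  have ha' : 0 ≤ ∑ i, ∑ j, a i j := Finset.sum_nonneg fun i _ => Finset.sum_nonneg fun j _ => ha0 i j
  have hb' : 0 ≤ ∑ i, b i := Finset.sum_nonneg fun i _ => hb0 i
  refine ⟨∑ i, ∑ j, a i j + ∑ i, b i, 4 / r, by positivity, by positivity, fun k => ?_,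
    fun k => ?_⟩
  · refine ContinuousLinearMap.opNorm_le_bound _ (by positivity) fun y => ?_
    rw [pi_norm_le_iff_of_nonneg (by positivity)]
    intro i
    rw [taylorMap_apply]
    calc _ ≤ ∑ j, a i j * (4 / r) ^ bideg k * ‖y‖ := by
          refine norm_sum_le_of_le _ fun j _ => ?_
          rw [norm_mul]
          gcongr
          · have := ha0 i j; positivity
          · exact ha i j k
          · exact norm_le_pi_norm y j
      _ = (∑ j, a i j) * (4 / r) ^ bideg k * ‖y‖ := by rw [Finset.sum_mul, Finset.sum_mul]
      _ ≤ _ := by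
          gcongr
          have := Finset.single_le_sum (f := fun i => ∑ j, a i j)
            (fun i _ => Finset.sum_nonneg fun j _ => ha0 i j) (Finset.mem_univ i)
          linarith
  · rw [pi_norm_le_iff_of_nonneg (by positivity)]
    intro i
    refine (hb i k).trans ?_
    gcongr
    have := Finset.single_le_sum (f := b) (fun i _ => hb0 i) (Finset.mem_univ i)
    linarith

theorem taylorMap_zero {l : ℕ} (C : ℂ × ℂ → Matrix (Fin l) (Fin l) ℂ) :
    taylorMap C 0 = LinearMap.toContinuousLinearMap (Matrix.toLin' (C (0, 0))) := by
  have : (Matrix.of fun i j => MvPowerSeries.coeff 0 (taylorSeries fun x => C x i j)) =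
      C (0, 0) := by
    ext i j
    change taylorSeries (fun x => C x i j) 0 = _
    simp [taylorSeries]
  rw [taylorMap, this]

/-- Cayley-Hamilton, written as a product of linear factors. -/
theorem prod_roots_charpoly_eq_zero {V : Type*} [NormedAddCommGroup V] [NormedSpace ℂ V]
    [FiniteDimensional ℂ V] (f : V →ₗ[ℂ] V) :
    (f.charpoly.roots.toList.map fun μ => LinearMap.toContinuousLinearMap f -
      μ • (1 : V →L[ℂ] V)).prod = 0 := by
  have h1 := f.aeval_self_charpoly
  rw [(IsAlgClosed.splits f.charpoly).eq_prod_roots_of_monic f.charpoly_monic,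
    ← Multiset.coe_toList f.charpoly.roots, Multiset.map_coe, Multiset.prod_coe, map_list_prod,
    List.map_map] at h1
  have h2 := congrArg (Module.End.toContinuousLinearMap V (𝕜 := ℂ)) h1
  rw [map_zero, map_list_prod, List.map_map] at h2
  rw [← h2]
  congr 1
  refine List.map_congr_left fun μ _ => ?_
  simp only [Function.comp_apply, map_sub, Polynomial.aeval_X, Polynomial.aeval_C, AlgEquiv.commutes]
  rw [Algebra.algebraMap_eq_smul_one]
  rfl

/-- The formal solution exists and is 1-summable in every direction that is not the argument of
an eigenvalue of `C (0, 0)`. -/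
theorem exists_formalSolution_oneSummableInDirection {l p q : ℕ} (hp : 0 < p) (hq : 0 < q) {s : ℝ}
    (hs₀ : 0 < s) (hs₁ : s < 1) {r : ℝ} (hr : 0 < r)
    {C : ℂ × ℂ → Matrix (Fin l) (Fin l) ℂ} {γ : ℂ × ℂ → Fin l → ℂ}
    (hC : ∀ i j, DifferentiableOn ℂ (fun x => C x i j) (ball 0 r ×ˢ ball 0 r))
    (hγ : ∀ i, DifferentiableOn ℂ (fun x => γ x i) (ball 0 r ×ˢ ball 0 r))
    (hinj : Function.Injective (Matrix.toLin' (C (0, 0)))) {d : ℝ}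
    (hd : ∀ μ : ℂ, Module.End.HasEigenvalue (Matrix.toLin' (C (0, 0))) μ →
      (d : Real.Angle) ≠ (μ.arg : Real.Angle)) :
    ∃ y : Fin l → MvPowerSeries (Fin 2) ℂ, IsFormalSolution p q s C γ y ∧
      OneSummableInDirection p q (vectorCoeff y) d := by
  set L := (Matrix.toLin' (C (0, 0))).charpoly.roots.toList with hLdef
  have hL : ∀ μ ∈ L, μ ≠ 0 ∧ dirRe d μ < ‖μ‖ := by
    intro μ hμ
    rw [hLdef, Multiset.mem_toList] at hμ
    have hev := (Module.End.hasEigenvalue_iff_isRoot_charpoly _ _).2 (Polynomial.isRoot_of_mem_roots hμ)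
    have hμ0 : μ ≠ 0 := by
      rintro rfl
      obtain ⟨v, hv⟩ := hev.exists_hasEigenvector
      have h1 := hv.apply_eq_smul
      rw [zero_smul] at h1
      exact hv.2 (hinj (h1.trans (map_zero _).symm))
    exact ⟨hμ0, dirRe_lt_norm hμ0 (hd μ hev)⟩
  obtain ⟨κ₀, m, B, h0, h1, hm, hB, hbd⟩ := exists_uniform_bounds L hL
  have hpi := Real.pi_pos
  -- The rays at angles d ± η must lie in the cone of aperture cos η, which must in turn exclude the
  -- eigenvalues: hence cos η > κ₀.
  obtain ⟨η, hη, hη', hκ⟩ : ∃ η : ℝ, 0 < η ∧ η < Real.pi / 4 ∧ κ₀ < Real.cos η := by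
    have hc : ∀ᶠ η in 𝓝 (0 : ℝ), κ₀ < Real.cos η :=
      Real.continuous_cos.continuousAt.eventually (lt_mem_nhds (by simpa using h1))
    have hc' : ∀ᶠ η in 𝓝[>] (0 : ℝ), κ₀ < Real.cos η := hc.filter_mono nhdsWithin_le_nhds
    obtain ⟨η, hη1, hη2⟩ := (hc'.and (Ioo_mem_nhdsGT (by positivity : (0 : ℝ) < Real.pi / 4))).exists
    exact ⟨η, hη2.1, hη2.2, hη1⟩
  set κ := Real.cos η with hκdef
  have hκ1 : κ ≤ 1 := Real.cos_le_one _
  have hκ0 : 0 < κ - κ₀ := by linarith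
  set ρ := (κ - κ₀) * m / 4 with hρ
  have hρ0 : 0 < ρ := by positivity
  set Ω := coneDomain d κ ρ with hΩ
  have hdom : ∀ μ ∈ L, IsBorelDomain Ω ((κ - κ₀) * min 1 (m / 2) / 4)
      ((B + 1) / ((κ - κ₀) * min 1 (m / 2) / 4)) μ := fun μ hμ =>
    isBorelDomain_coneDomain h0 hκ hκ1 hm (hbd μ hμ).1 (hbd μ hμ).2.1 (hbd μ hμ).2.2
  have hO : IsOpen Ω := isOpen_coneDomain _ _ _
  have hball : closedBall 0 (ρ / 4) ⊆ Ω := by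
    intro ξ hξ
    rw [mem_closedBall_zero_iff] at hξ
    change κ * ‖ξ‖ - ρ < dirRe d ξ
    have e1 := (abs_le.1 (abs_dirRe_le d ξ)).1
    have e2 : κ * ‖ξ‖ ≤ ‖ξ‖ := mul_le_of_le_one_left (norm_nonneg _) hκ1
    linarith
  have hzero : (0 : ℂ) ∈ Ω := hball (mem_closedBall_self (by positivity))
  have hray : ∀ θ : ℝ, Real.cos (θ - d) = κ → ∀ t : ℝ, 0 ≤ t →
      t * Complex.exp (θ * Complex.I) ∈ Ω := by
    intro θ hθ t ht
    change κ * ‖_‖ - ρ < dirRe d _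
    rw [dirRe_real_mul, dirRe_exp, hθ, norm_mul, Complex.norm_exp_ofReal_mul_I, Complex.norm_real,
      Real.norm_of_nonneg ht]
    linarith
  obtain ⟨A, a, hA, ha, hCb, hγb⟩ := exists_norm_taylorMap_le hr hC hγ
  have hprod : (L.map fun μ => taylorMap C 0 - μ • (1 : (Fin l → ℂ) →L[ℂ] (Fin l → ℂ))).prod = 0 := by
    rw [taylorMap_zero]
    exact prod_roots_charpoly_eq_zero _
  obtain ⟨U, M, Q, hM, hQ, hU, hU0, hU1, hF0, hF⟩ := exists_borel_transform hO hzero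
    (by positivity) (taylorMap C) L hdom hprod (eulerWeight p q s)
    (eulerWeight_nonneg p q hs₀.le hs₁.le) (eulerWeight_le p q hp hq hs₀.le hs₁.le)
    (eulerWeight_add p q s) (fun k i => MvPowerSeries.coeff k (taylorSeries fun x => γ x i))
    hA ha hCb hγb
  let F : ℕ → (Fin 2 →₀ ℕ) → Fin l → ℂ := fun n k => iteratedDeriv n (U k) 0
  let y : Fin l → MvPowerSeries (Fin 2) ℂ := fun i k => unfoldedCoeff F (expo p q) k i
  have hy : ∀ k, (fun i => MvPowerSeries.coeff k (y i)) = unfoldedCoeff F (expo p q) k :=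
    fun k => rfl
  refine ⟨y, ?_, ?_⟩
  · rw [isFormalSolution_iff]
    intro k
    simp only [hy]
    exact unfoldedCoeff_equation (F := F) hp hq (by simpa [F] using hF0) hF k
  · exact oneSummableInDirection_of_borel hp hO (convex_coneDomain (h0.trans hκ.le))
      (by positivity : 0 < ρ / 4) hball hη hη'
      (hray (d - η) (by rw [sub_sub_cancel_left, Real.cos_neg]))
      (hray (d + η) (by rw [add_sub_cancel_left])) hM hQ hU hU0 hU1 (fun n m => rfl)

end MonomialSummability

/-! ### The main theorem -/

theorem theorem5p2 (l p q : ℕ) (hp : 0 < p) (hq : 0 < q) (s : ℝ) (hs₀ : 0 < s) (hs₁ : s < 1)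
    (r : ℝ) (hr : 0 < r)
    (C : ℂ × ℂ → Matrix (Fin l) (Fin l) ℂ) (γ : ℂ × ℂ → Fin l → ℂ)
    (hC : ∀ i j, DifferentiableOn ℂ (fun x => C x i j) (Metric.ball 0 r ×ˢ Metric.ball 0 r))
    (hγ : ∀ i, DifferentiableOn ℂ (fun x => γ x i) (Metric.ball 0 r ×ˢ Metric.ball 0 r))
    (hinv : IsUnit (C (0, 0))) :
    ∃ y : Fin l → MvPowerSeries (Fin 2) ℂ,
      MonomialSummability.IsFormalSolution p q s C γ y ∧
      (∀ z : Fin l → MvPowerSeries (Fin 2) ℂ,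
        MonomialSummability.IsFormalSolution p q s C γ z → z = y) ∧
      MonomialSummability.OneSummable p q (MonomialSummability.vectorCoeff y) ∧
      ∀ d : ℝ,
        (d : Real.Angle) ∈ MonomialSummability.singularDirections p q (MonomialSummability.vectorCoeff y) →
        ∃ μ : ℂ, Module.End.HasEigenvalue (Matrix.toLin' (C (0, 0))) μ ∧
          (d : Real.Angle) = (μ.arg : Real.Angle) := by
  have hinj : Function.Injective (Matrix.toLin' (C (0, 0))) := by
    exact fun v w hvw => Matrix.mulVec_injective_of_isUnit hinv
      (by simpa only [Matrix.toLin'_apply] using hvw)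
  have hinj' : Function.Injective (MonomialSummability.taylorMap C 0) := by
    rw [MonomialSummability.taylorMap_zero]; exact hinj
  have hfin : {μ : ℂ | Module.End.HasEigenvalue (Matrix.toLin' (C (0, 0))) μ}.Finite := by
    refine (Multiset.finite_toSet (Matrix.toLin' (C (0, 0))).charpoly.roots).subset fun μ hμ => ?_
    exact (Polynomial.mem_roots (LinearMap.charpoly_monic _).ne_zero).2
      ((Module.End.hasEigenvalue_iff_isRoot_charpoly _ _).1 hμ)
  have hsol := fun d hd => MonomialSummability.exists_formalSolution_oneSummableInDirection
    hp hq hs₀ hs₁ hr hC hγ hinj (d := d) hd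
  -- The construction of a formal solution depends on a direction, so one avoiding the finitely many
  -- arguments of eigenvalues is fixed to define y.
  obtain ⟨d₀, hd₀, hd₀'⟩ := (Set.Ioc_infinite
    (by linarith [Real.pi_pos] : -Real.pi < Real.pi)).exists_notMem_finite (hfin.image Complex.arg)
  obtain ⟨y, hy, -⟩ := hsol d₀ fun μ hμ heq => hd₀' ⟨μ, hμ, by
    have h1 := Real.Angle.toReal_coe_eq_self_iff_mem_Ioc.2 hd₀
    rw [heq, Complex.arg_coe_angle_toReal_eq_arg] at h1
    exact h1⟩
  have huniq : ∀ z, MonomialSummability.IsFormalSolution p q s C γ z → z = y := fun z hz =>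
    MonomialSummability.IsFormalSolution.eq hp hinj' hy hz
  have hsing : ∀ d : ℝ, (d : Real.Angle) ∈
      MonomialSummability.singularDirections p q (MonomialSummability.vectorCoeff y) →
      ∃ μ : ℂ, Module.End.HasEigenvalue (Matrix.toLin' (C (0, 0))) μ ∧
        (d : Real.Angle) = (μ.arg : Real.Angle) := by
    rintro d ⟨d', hd', hdd'⟩
    by_contra! hcon
    -- The solution built for d' is y by uniqueness, so y inherits its summability.
    obtain ⟨z, hz, hzs⟩ := hsol d' fun μ hμ heq => hcon μ hμ (hdd'.symm.trans heq)
    rw [huniq z hz] at hzs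
    exact hd' hzs
  refine ⟨y, hy, huniq, ?_, hsing⟩
  refine (hfin.image fun μ : ℂ => (μ.arg : Real.Angle)).subset ?_
  rintro _ ⟨d, hd, rfl⟩
  obtain ⟨μ, hμ, heq⟩ := hsing d ⟨d, hd, rfl⟩
  exact ⟨μ, hμ, heq.symm⟩
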